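/- Let $t\ge 0$, $n=3t+1$, and let $\mathbb V$ be a set of possible input and decision values with more than $n$ elements. **Model.** $n$ parties communicate over asynchronous point-to-point links. The local state of a party is its input $v_i\in\mathbb V$ and the sequence of its local events (actions performed, messages received). A randomized algorithm $\mathcal A$ prescribes the next action of each party as a function of its local state: an internal step, a decision on a value of $\mathbb V$, sending a message, or accessing a probabilistic object. The objects are specified by $\mathcal A$: an access returns a value drawn from a discrete law that depends on the state of the object, the accessing party and the query, and may change that state. At each point in time the adversary chooses either a party that takes a step or a pending message that is delivered. A strategy of a *weak and static* adversary fixes from the start (knowing the inputs) a set of $f\le t$ corrupted parties. Its choices, including the arbitrary actions of the corrupted parties, depend only on what it has observed so far: which parties have output a decision, which messages are pending on which links (not their contents), and the local states of the corrupted parties. An *ensemble* of $\mathcal A$ consists of inputs $(v_i)$ and such a strategy that is fair with probability one (every honest party moves infinitely often, every message sent is eventually delivered). It induces a tree of executions and a probability measure on its infinite paths. Let $\mathcal V_{in}$ be the multiset of all inputs, and $\mathrm{max\_mult}(\mathcal V_{in})$ the largest multiplicity of a value in it. Fix a class $\mathcal S$ of strategies of weak and static adversaries (for example all of them, or the computationally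 bounded ones) that contains at least the elementary ones: each corrupted party stays silent or runs $\mathcal A$ with an input chosen by the adversary, and the scheduling (steps, and deliveries of the oldest pending message of a link) is read off a finite table from the time modulo the length of the table and the set of parties that have decided. All requirements below concern ensembles with strategies in $\mathcal S$. - *Agreement*: in every path of every ensemble all honest parties that decide output the same value. - *Probabilistic Termination*: in every ensemble every honest party decides with probability $1$. - *Qualitative Validity*: in every ensemble with $f$ corrupted parties and inputs $\mathcal V_{in}$, if $\mathrm{max\_mult}(\mathcal V_{in})-f\ge 2t+1$, then in every path all honest parties that decide output values in $\mathcal V_{in}$; otherwise the probability that the honest parties decide on a value in $\mathcal V_{in}$ is at least $1-\frac{f}{n-t}$. A property $\Phi$ of algorithms is *strictly stronger* than Qualitative Validity if every algorithm that satisfies $\Phi$ satisfies Qualitative Validity and, in addition, there are $\hat f\le t$ and a multiset $\mathcal V_{in}$ of $n$ values with $\mathrm{max\_mult}(\mathcal V_{in})-\hat f<2t+1$ such that in every ensemble with $\hat f$ corrupted parties and inputs $\mathcal V_{in}$ the probability that the honest parties decide on a value in $\mathcal V_{in}$ is strictly larger than $1-\frac{\hat f}{n-t}$. **Theorem.** If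 $\Phi$ is strictly stronger than Qualitative Validity, then no algorithm satisfies Agreement, Probabilistic Termination and $\Phi$. -/

import Mathlib

open MeasureTheory ProbabilityTheory

namespace ByzAgr

universe u w

/-- The `n = 3t + 1` parties. -/
abbrev Party (t : ℕ) : Type := Fin (3 * t + 1)

/-- An action that a party can take in one local step: an internal step, outputting a decision,
sending a message on a link, or accessing a probabilistic object with some query. -/
inductive Action (t : ℕ) (V : Type u) (Msg Obj Query : Type w) : Type (max u w)
  | skip : Action t V Msg Obj Query
  | decide (x : V) : Action t V Msg Obj Query
  | send (dst : Party t) (m : Msg) : Action t V Msg Obj Query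
  | access (o : Obj) (q : Query) : Action t V Msg Obj Query

/-- A local event at a party: an action it performed (an access is recorded together with the value
returned by the object), or the receipt of a message. -/
inductive LocalEvent (t : ℕ) (V : Type u) (Msg Obj Query Ret : Type w) : Type (max u w)
  | skip : LocalEvent t V Msg Obj Query Ret
  | decide (x : V) : LocalEvent t V Msg Obj Query Ret
  | send (dst : Party t) (m : Msg) : LocalEvent t V Msg Obj Query Ret
  | access (o : Obj) (q : Query) (r : Ret) : LocalEvent t V Msg Obj Query Ret
  | recv (src : Party t) (m : Msg) : LocalEvent t V Msg Obj Query Ret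

/-- A randomized message-passing algorithm for `3t + 1` parties with inputs and decisions in `V`.
`prog` gives the next action of a party as a function of its local state (its input and the
sequence of its local events, oldest first). The specification of the probabilistic objects is part
of the algorithm: an access returns a random value (with a discrete law) depending on the state of
the object, the accessing party and the query, and then changes the state of that object. -/
structure Algorithm (t : ℕ) (V : Type u) where
  Msg : Type w
  Obj : Type w
  Query : Type w
  Ret : Type w
  ObjState : Type w
  prog : Party t → V → List (LocalEvent t V Msg Obj Query Ret) → Action t V Msg Obj Query
  objInit : Obj → ObjState
  objRet : Obj → ObjState → Party t → Query → PMF Ret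
  objNext : Obj → ObjState → Party t → Query → Ret → ObjState

variable {t : ℕ} {V : Type u}

/-- The actions of the parties that run `A`. -/
abbrev Algorithm.Act (A : Algorithm.{u, w} t V) : Type (max u w) :=
  Action t V A.Msg A.Obj A.Query

/-- The local events of the parties that run `A`. -/
abbrev Algorithm.Event (A : Algorithm.{u, w} t V) : Type (max u w) :=
  LocalEvent t V A.Msg A.Obj A.Query A.Ret

/-- A local state: the input and the finite sequence of local events so far, oldest first. -/
structure LocalState (A : Algorithm.{u, w} t V) where
  input : V
  events : List A.Event

/-- The value `x` has been output as a decision in this local state. -/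
def LocalState.Decided {A : Algorithm.{u, w} t V} (s : LocalState A) (x : V) : Prop :=
  LocalEvent.decide x ∈ s.events

/-- A configuration. The `m`-th message sent on the link from `i` to `j` is `(sent i j)[m]`;
it is pending as long as `m ∉ delivered i j`. -/
structure Config (A : Algorithm.{u, w} t V) where
  loc : Party t → LocalState A
  sent : Party t → Party t → List A.Msg
  delivered : Party t → Party t → Finset ℕ
  obj : A.Obj → A.ObjState

/-- The initial configuration with the given inputs. -/
def Config.init (A : Algorithm.{u, w} t V) (inputs : Party t → V) : Config A where
  loc i := ⟨inputs i, []⟩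
  sent _ _ := []
  delivered _ _ := ∅
  obj := A.objInit

/-- The indices of the pending messages on the link from `i` to `j`. -/
def Config.pending {A : Algorithm.{u, w} t V} (c : Config A) (i j : Party t) : Finset ℕ :=
  Finset.range (c.sent i j).length \ c.delivered i j

/-- Append a local event to the local state of party `i`. -/
def Config.log {A : Algorithm.{u, w} t V} (c : Config A) (i : Party t) (e : A.Event) : Config A :=
  { c with loc := Function.update c.loc i ⟨(c.loc i).input, (c.loc i).events ++ [e]⟩ }

/-- Delivery to `j` of the `m`-th message sent by `i` to `j`. If no such message is pending, then
nothing happens. -/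
def Config.deliver {A : Algorithm.{u, w} t V} (c : Config A) (i j : Party t) (m : ℕ) : Config A :=
  match (c.sent i j)[m]? with
  | none => c
  | some x =>
    if m ∈ c.delivered i j then c
    else
      { c.log j (LocalEvent.recv i x) with
        delivered := fun i' j' =>
          if i' = i ∧ j' = j then insert m (c.delivered i j) else c.delivered i' j' }

open Classical in
/-- Party `i` performs the action `a`: the law of the next configuration. Only an access to a
probabilistic object is random. -/
noncomputable def Config.perform {A : Algorithm.{u, w} t V} (c : Config A) (i : Party t) :
    A.Act → PMF (Config A)
  | Action.skip => PMF.pure (c.log i LocalEvent.skip)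
  | Action.decide x => PMF.pure (c.log i (LocalEvent.decide x))
  | Action.send j m => PMF.pure
      { c.log i (LocalEvent.send j m) with
        sent := fun i' j' => if i' = i ∧ j' = j then c.sent i j ++ [m] else c.sent i' j' }
  | Action.access o q => (A.objRet o (c.obj o) i q).map fun r =>
      { c.log i (LocalEvent.access o q r) with
        obj := Function.update c.obj o (A.objNext o (c.obj o) i q r) }

/-- A scheduling decision: the party that takes the next local step, or the message (the `m`-th one
on the link from `i` to `j`) that is delivered. -/
inductive Sched (t : ℕ) : Type
  | step (i : Party t) : Sched t
  | deliver (i j : Party t) (m : ℕ) : Sched t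

/-- What a weak adversary sees of a configuration: which parties have output a decision, which
messages are pending on the links (but not their contents), and the local states of the corrupted
parties. The local states of the honest parties, the contents of messages in transit
and the states of the probabilistic objects are not visible. -/
structure Observation (A : Algorithm.{u, w} t V) where
  hasDecided : Set (Party t)
  pending : Party t → Party t → Finset ℕ
  corruptedState : Party t → Option (LocalState A)

/-- The observation of a configuration by an adversary that has corrupted the given parties. -/
def Config.observe {A : Algorithm.{u, w} t V} (corrupted : Finset (Party t)) (c : Config A) :
    Observation A where
  hasDecided := {i | ∃ x, (c.loc i).Decided x}
  pending := c.pending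
  corruptedState i := if i ∈ corrupted then some (c.loc i) else none

/-- A strategy of a weak and static adversary: a set of at most `t` corrupted parties, fixed from
the start, and, as functions of the past observations (newest first) and the present one,
the next scheduling decision and the action of each corrupted party, should it be scheduled. -/
structure Strategy (A : Algorithm.{u, w} t V) where
  corrupted : Finset (Party t)
  card_corrupted_le : corrupted.card ≤ t
  sched : List (Observation A) → Observation A → Sched t
  byz : List (Observation A) → Observation A → Party t → A.Act

/-- A node of the tree of executions: a configuration together with the observations that the
adversary made at its ancestors (newest first). -/
structure Node (A : Algorithm.{u, w} t V) where
  past : List (Observation A)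
  conf : Config A

instance (A : Algorithm.{u, w} t V) : MeasurableSpace (Node A) := ⊤

variable {A : Algorithm.{u, w} t V}

/-- The scheduling decision of the strategy at a node. -/
def Strategy.choice (σ : Strategy A) (v : Node A) : Sched t :=
  σ.sched v.past (v.conf.observe σ.corrupted)

/-- The law of the configuration that follows a node: honest parties act as the algorithm
prescribes, corrupted ones as the strategy does. -/
noncomputable def Strategy.nextConf (σ : Strategy A) (v : Node A) : PMF (Config A) :=
  match σ.choice v with
  | Sched.step i =>
    v.conf.perform i
      (if i ∈ σ.corrupted then σ.byz v.past (v.conf.observe σ.corrupted) i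
        else A.prog i (v.conf.loc i).input (v.conf.loc i).events)
  | Sched.deliver i j m => PMF.pure (v.conf.deliver i j m)

/-- The weights of the edges from a node to its children. -/
noncomputable def Strategy.next (σ : Strategy A) (v : Node A) : PMF (Node A) :=
  (σ.nextConf v).map fun c => ⟨v.conf.observe σ.corrupted :: v.past, c⟩

/-- The transition kernel of the tree. -/
noncomputable def Strategy.kernel (σ : Strategy A) : Kernel (Node A) (Node A) where
  toFun v := (σ.next v).toMeasure
  measurable' := measurable_from_top

instance (σ : Strategy A) : IsMarkovKernel σ.kernel :=
  ⟨fun v => (inferInstance : IsProbabilityMeasure (σ.next v).toMeasure)⟩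

/-- The root of the tree. -/
def root (A : Algorithm.{u, w} t V) (inputs : Party t → V) : Node A :=
  ⟨[], Config.init A inputs⟩

/-- The transition kernel from the history up to time `k`, which depends on the node at time `k`
only. -/
noncomputable def Strategy.histKernel (σ : Strategy A) (k : ℕ) :
    Kernel (∀ _ : Finset.Iic k, Node A) (Node A) :=
  σ.kernel.comap (fun h => h ⟨k, Finset.mem_Iic.2 le_rfl⟩) (measurable_pi_apply _)

instance (σ : Strategy A) (k : ℕ) : IsMarkovKernel (σ.histKernel k) :=
  inferInstanceAs (IsMarkovKernel (σ.kernel.comap _ _))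

/-- The probability measure on infinite sequences of nodes, under which the sequences through
a given node have as probability the product of the weights on the way from the root to it. -/
noncomputable def Strategy.pathMeasure (σ : Strategy A) (inputs : Party t → V) :
    Measure (ℕ → Node A) :=
  Kernel.traj (X := fun _ => Node A) σ.histKernel 0 (fun _ => root A inputs)

instance (σ : Strategy A) (inputs : Party t → V) : IsProbabilityMeasure (σ.pathMeasure inputs) :=
  inferInstanceAs (IsProbabilityMeasure (Kernel.traj (X := fun _ => Node A) σ.histKernel 0 _))

/-- Fairness of an infinite path: every honest party is scheduled infinitely often, and every
message sent is eventually delivered. -/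
def Strategy.Fair (σ : Strategy A) (ω : ℕ → Node A) : Prop :=
  (∀ i, i ∉ σ.corrupted → ∀ k, ∃ k' ≥ k, σ.choice (ω k') = Sched.step i) ∧
  (∀ i j k m, m ∈ (ω k).conf.pending i j → ∃ k', m ∈ (ω k').conf.delivered i j)

/-- An ensemble of the algorithm `A`: the tree of executions determined by the inputs and by a
strategy of a weak and static adversary that is fair with probability one. -/
structure Ensemble (A : Algorithm.{u, w} t V) where
  inputs : Party t → V
  strategy : Strategy A
  fair : ∀ᵐ ω ∂(strategy.pathMeasure inputs), strategy.Fair ω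

namespace Ensemble

/-- The probability measure on the paths of the ensemble. -/
noncomputable abbrev prob (E : Ensemble A) : Measure (ℕ → Node A) :=
  E.strategy.pathMeasure E.inputs

/-- The paths of the ensemble: all edges have positive weight. -/
def IsPath (E : Ensemble A) (ω : ℕ → Node A) : Prop :=
  ω 0 = root A E.inputs ∧ ∀ k, ω (k + 1) ∈ (E.strategy.next (ω k)).support

/-- The multiset of all inputs. -/
def inputMultiset (E : Ensemble A) : Multiset V := Finset.univ.val.map E.inputs

/-- The number of corrupted parties. -/
def numCorrupted (E : Ensemble A) : ℕ := E.strategy.corrupted.card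

/-- Party `i` is honest. -/
def Honest (E : Ensemble A) (i : Party t) : Prop := i ∉ E.strategy.corrupted

/-- Party `i` decides `x` in the execution `ω`. -/
def Decides (ω : ℕ → Node A) (i : Party t) (x : V) : Prop :=
  ∃ k, ((ω k).conf.loc i).Decided x

/-- In every path, an honest party that decides, decides on an input value. -/
def AlwaysDecidesInput (E : Ensemble A) : Prop :=
  ∀ ω, E.IsPath ω → ∀ i, E.Honest i → ∀ x, Decides ω i x → x ∈ E.inputMultiset

/-- The probability that the honest parties decide on an input value. -/
noncomputable def probDecidesInput (E : Ensemble A) : ℝ :=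
  E.prob.real {ω | ∀ i, E.Honest i → ∃ x ∈ E.inputMultiset, Decides ω i x}

end Ensemble

open Classical in
/-- The maximal multiplicity of an element of a multiset. -/
noncomputable def maxMult (M : Multiset V) : ℕ := M.toFinset.sup fun x => M.count x

/-- A type of weak and static adversaries: the strategies that are available against an
algorithm. -/
abbrev AdversaryClass (t : ℕ) (V : Type u) : Type (max u (w + 1)) :=
  ∀ A : Algorithm.{u, w} t V, Set (Strategy A)

/-- Agreement: in every path of every ensemble, all honest parties that decide output the same
value. -/
def Agreement (Adv : AdversaryClass.{u, w} t V) (A : Algorithm.{u, w} t V) : Prop :=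
  ∀ E : Ensemble A, E.strategy ∈ Adv A → ∀ ω, E.IsPath ω →
    ∀ i j, E.Honest i → E.Honest j →
      ∀ x y, Ensemble.Decides ω i x → Ensemble.Decides ω j y → x = y

/-- Probabilistic Termination: in every ensemble every honest party decides with probability 1. -/
def ProbTermination (Adv : AdversaryClass.{u, w} t V) (A : Algorithm.{u, w} t V) : Prop :=
  ∀ E : Ensemble A, E.strategy ∈ Adv A →
    ∀ i, E.Honest i → ∀ᵐ ω ∂E.prob, ∃ x, Ensemble.Decides ω i x

/-- Qualitative Validity. -/
def QualitativeValidity (Adv : AdversaryClass.{u, w} t V) (A : Algorithm.{u, w} t V) : Prop :=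
  ∀ E : Ensemble A, E.strategy ∈ Adv A →
    ((2 * t + 1 : ℤ) ≤ (maxMult E.inputMultiset : ℤ) - E.numCorrupted →
      E.AlwaysDecidesInput) ∧
    ((maxMult E.inputMultiset : ℤ) - E.numCorrupted < (2 * t + 1 : ℤ) →
      1 - (E.numCorrupted : ℝ) / ((3 * t + 1 : ℝ) - t) ≤ E.probDecidesInput)

/-- For some number `f ≤ t` of corrupted parties and some multiset `M` of `3t + 1` inputs outside
the first case of Qualitative Validity, the bound of Qualitative Validity is strictly exceeded
in every ensemble with this number of corrupted parties and these inputs. -/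
def StrictSomewhere (Adv : AdversaryClass.{u, w} t V) (A : Algorithm.{u, w} t V) : Prop :=
  ∃ f : ℕ, f ≤ t ∧ ∃ M : Multiset V, M.card = 3 * t + 1 ∧
    (maxMult M : ℤ) - f < (2 * t + 1 : ℤ) ∧
    ∀ E : Ensemble A, E.strategy ∈ Adv A → E.numCorrupted = f → E.inputMultiset = M →
      1 - (f : ℝ) / ((3 * t + 1 : ℝ) - t) < E.probDecidesInput

/-- The validity property `Φ` of algorithms is strictly stronger than Qualitative Validity. -/
def StrictlyStronger (Adv : AdversaryClass.{u, w} t V) (Φ : Algorithm.{u, w} t V → Prop) : Prop :=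
  ∀ A, Φ A → QualitativeValidity Adv A ∧ StrictSomewhere Adv A

/-- An entry of a scheduling table: let a party take a step, or deliver the oldest pending message
of a link (if there is one). -/
inductive Entry (t : ℕ) : Type
  | step (i : Party t) : Entry t
  | deliverOldest (i j : Party t) : Entry t

/-- An elementary strategy, which needs no computing power beyond that of the parties. Each
corrupted party either stays silent (`pretend i = none`) or runs the algorithm as if its input were
`x` (`pretend i = some x`). The scheduling is read off a finite table, from the time modulo the
length of the table and the set of parties that have output a decision. -/
noncomputable def elementaryStrategy (A : Algorithm.{u, w} t V) (corrupted : Finset (Party t))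
    (hc : corrupted.card ≤ t) (pretend : Party t → Option V) (len : ℕ)
    (table : Fin (len + 1) → Set (Party t) → Entry t) : Strategy A where
  corrupted := corrupted
  card_corrupted_le := hc
  sched past now :=
    match table (Fin.ofNat (len + 1) past.length) now.hasDecided with
    | Entry.step i => Sched.step i
    | Entry.deliverOldest i j => Sched.deliver i j (sInf (now.pending i j : Set ℕ))
  byz _ now i :=
    match pretend i, now.corruptedState i with
    | some x, some s => A.prog i x s.events
    | _, _ => Action.skip

/-- The adversary is at least able to use the elementary strategies. This is so if it may use all
strategies, and also if it is computationally bounded but able to run the algorithm itself. -/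
def CanRunAlgorithm (Adv : AdversaryClass.{u, w} t V) : Prop :=
  ∀ (A : Algorithm.{u, w} t V) (corrupted : Finset (Party t)) (hc : corrupted.card ≤ t)
    (pretend : Party t → Option V) (len : ℕ) (table : Fin (len + 1) → Set (Party t) → Entry t),
    elementaryStrategy A corrupted hc pretend len table ∈ Adv A

end ByzAgr

open MeasureTheory ProbabilityTheory

namespace ByzAgr

universe u w

/-! The argument is one of indistinguishability combined with a count. Suppose that an algorithm has
Agreement, Termination and Qualitative Validity, and let `f ≥ 1` and `M` be the parameters at which
the bound is supposedly exceeded. Since no value occurs more than `2t + f` times in `M`, the inputs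
can be arranged around a set `C` of `f` parties and a disjoint set `D` of `t` parties so that the
remaining `2t + 1 - f` parties share no value more than `t` times (`exists_balanced_arrangement`).
Let `z` be a value that is not in `M`.

Consider the run in which `C` and `D` have input `z`, the others keep their inputs, and `D` takes no
step until all the others have decided. Stopped at that moment, it does not depend on the inputs of
`D`, and it looks the same in several ensembles. If all parties are honest, validity forces a common
decision on `z` or on one of the other inputs `a`. If the holders of a value `a ≠ z`, at most `t` in
number, are corrupted and only pretend to have input `a`, then `a` is not an input, and validity
bounds the probability of deciding `a` by (number of holders)`/(2t + 1)`. If `C` is corrupted and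
only pretends to have `z`, while the true inputs form `M`, then deciding `z` means failing to decide
an input. Summing, `1 ≤ (1 - p) + (2t + 1 - f)/(2t + 1)`, where `p` is the probability of deciding
an input in the last ensemble. Hence `p ≤ 1 - f/(2t + 1)`, against strictness.

The delay is fair only if it ends, whereas Termination speaks of fair ensembles only. The circle is
broken by first corrupting `D` itself (`tendsto_stoppedProb_doneOutside`) and carrying the
conclusion over through the stopped run (`delayStrategy_ae_fair`). The count is
`exists_ensemble_probDecidesInput_le`. -/

variable {t : ℕ} {V : Type u} {A : Algorithm.{u, w} t V}

/-! ### Marginals of the path measure, and almost sure paths -/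

theorem lintegral_pmf_toMeasure {α : Type*} [m : MeasurableSpace α] (hm : m = ⊤) (p : PMF α)
    (f : α → ENNReal) : ∫⁻ a, f a ∂p.toMeasure = ∑' a, p a * f a := by
  subst hm
  let _ : MeasurableSpace α := ⊤
  have h : p.toMeasure = Measure.sum fun a => p a • Measure.dirac a := by
    refine Measure.ext fun s hs => ?_
    rw [PMF.toMeasure_apply_eq_tsum, Measure.sum_apply _ hs]
    refine tsum_congr fun a => ?_
    rw [Measure.smul_apply, Measure.dirac_apply' _ hs]
    by_cases ha : a ∈ s <;> simp [ha]
  rw [h, lintegral_sum_measure]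
  refine tsum_congr fun a => ?_
  rw [lintegral_smul_measure, lintegral_dirac' _ measurable_from_top, smul_eq_mul]

/-- The law of the node at time `n` of the tree that starts in the node `v`. -/
noncomputable def Strategy.law (σ : Strategy A) : ℕ → Node A → PMF (Node A)
  | 0, v => PMF.pure v
  | n + 1, v => (σ.next v).bind (σ.law n)

theorem Strategy.law_succ_eq_bind_next (σ : Strategy A) (n : ℕ) (v : Node A) :
    σ.law (n + 1) v = (σ.law n v).bind σ.next := by
  induction n generalizing v with
  | zero => simp only [law, PMF.pure_bind]; exact PMF.bind_pure _
  | succ n ih =>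
    conv_lhs => rw [law]
    conv_rhs => rw [law, PMF.bind_bind]
    congr 1
    exact funext ih

theorem measurableSet_node (s : Set (Node A)) : MeasurableSet s := trivial

theorem measurable_eval (n : ℕ) : Measurable fun ω : ℕ → Node A => ω n :=
  measurable_pi_apply n

theorem measurableSet_eval (n : ℕ) (B : Set (Node A)) :
    MeasurableSet {ω : ℕ → Node A | ω n ∈ B} :=
  measurable_eval n (measurableSet_node B)

/-- This is the only place where the joint law of successive nodes is unfolded from the
Ionescu-Tulcea construction; the marginals and the almost sure use of positive edges both follow
from it. -/
theorem Strategy.pathMeasure_two_steps (σ : Strategy A) (inputs : Party t → V) (n : ℕ)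
    (B B' : Set (Node A)) :
    σ.pathMeasure inputs {ω | ω n ∈ B ∧ ω (n + 1) ∈ B'} =
      ∫⁻ ω, B.indicator (fun v => (σ.next v).toMeasure B') (ω n) ∂(σ.pathMeasure inputs) := by
  have hmap := Kernel.partialTraj_compProd_eq_map_traj (κ := σ.histKernel)
    (X := fun _ => Node A) (Nat.zero_le n) (x₀ := fun _ => root A inputs)
  have hpath : σ.pathMeasure inputs =
      Kernel.traj (X := fun _ => Node A) σ.histKernel 0 (fun _ => root A inputs) := rfl
  have hlaw := Kernel.traj_map_frestrictLe_apply (κ := σ.histKernel)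
    (X := fun _ => Node A) 0 n (fun _ => root A inputs)
  have hW : MeasurableSet {x : (Π i : Finset.Iic n, Node A) × Node A |
      x.1 ⟨n, Finset.mem_Iic.2 le_rfl⟩ ∈ B ∧ x.2 ∈ B'} := by
    refine MeasurableSet.inter ?_ ?_
    · exact ((measurable_pi_apply (⟨n, Finset.mem_Iic.2 le_rfl⟩ : Finset.Iic n)).comp
        measurable_fst) (measurableSet_node B)
    · exact measurable_snd (measurableSet_node B')
  have hmeas : Measurable fun h : (Π i : Finset.Iic n, Node A) =>
      B.indicator (fun v => (σ.next v).toMeasure B') (h ⟨n, Finset.mem_Iic.2 le_rfl⟩) :=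
    (measurable_from_top (f := B.indicator (fun v => (σ.next v).toMeasure B'))).comp
      (measurable_pi_apply (⟨n, Finset.mem_Iic.2 le_rfl⟩ : Finset.Iic n))
  have h1 : σ.pathMeasure inputs {ω | ω n ∈ B ∧ ω (n + 1) ∈ B'} =
      ((Kernel.partialTraj (X := fun _ => Node A) σ.histKernel 0 n (fun _ => root A inputs)) ⊗ₘ
        (σ.histKernel n)) {x | x.1 ⟨n, Finset.mem_Iic.2 le_rfl⟩ ∈ B ∧ x.2 ∈ B'} := by
    rw [hmap, Measure.map_apply (by fun_prop) hW]
    rfl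
  rw [h1, Measure.compProd_apply hW, hpath]
  have h2 : ∫⁻ ω, B.indicator (fun v => (σ.next v).toMeasure B') (ω n)
      ∂(Kernel.traj (X := fun _ => Node A) σ.histKernel 0 (fun _ => root A inputs)) =
      ∫⁻ h, B.indicator (fun v => (σ.next v).toMeasure B') (h ⟨n, Finset.mem_Iic.2 le_rfl⟩)
      ∂(Kernel.partialTraj (X := fun _ => Node A) σ.histKernel 0 n (fun _ => root A inputs)) := by
    rw [← hlaw, lintegral_map hmeas (by fun_prop)]
    rfl
  rw [h2]
  refine lintegral_congr fun h => ?_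
  by_cases hB : h ⟨n, Finset.mem_Iic.2 le_rfl⟩ ∈ B
  · rw [Set.indicator_of_mem hB]
    have h4 : (σ.next (h ⟨n, Finset.mem_Iic.2 le_rfl⟩)).toMeasure = σ.histKernel n h := rfl
    rw [h4]
    congr 1
    ext ω
    simp [hB]
  · rw [Set.indicator_of_notMem hB]
    simp [hB]

theorem Strategy.pathMeasure_eval_zero (σ : Strategy A) (inputs : Party t → V) :
    (σ.pathMeasure inputs).map (fun ω => ω 0) = (PMF.pure (root A inputs)).toMeasure := by
  have hlaw := Kernel.traj_map_frestrictLe_apply (κ := σ.histKernel)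
    (X := fun _ => Node A) 0 0 (fun _ => root A inputs)
  rw [Kernel.partialTraj_self, Kernel.id_apply] at hlaw
  have hm : Measurable fun h : (Π i : Finset.Iic 0, Node A) => h ⟨0, Finset.mem_Iic.2 le_rfl⟩ :=
    measurable_pi_apply _
  have h : (σ.pathMeasure inputs).map (fun ω => ω 0) =
      ((σ.pathMeasure inputs).map (Preorder.frestrictLe (π := fun _ => Node A) 0)).map
        (fun h => h ⟨0, Finset.mem_Iic.2 le_rfl⟩) := by
    rw [Measure.map_map hm (by fun_prop)]
    rfl
  rw [h, PMF.toMeasure_pure]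
  refine Eq.trans (congrArg _ hlaw) ?_
  exact Measure.map_dirac' hm _

/-- The law of the node at time `n` under the path measure. -/
theorem Strategy.pathMeasure_eval (σ : Strategy A) (inputs : Party t → V) (n : ℕ) :
    (σ.pathMeasure inputs).map (fun ω => ω n) = (σ.law n (root A inputs)).toMeasure := by
  induction n with
  | zero => exact σ.pathMeasure_eval_zero inputs
  | succ n ih =>
    refine Measure.ext fun B hB => ?_
    rw [Measure.map_apply (measurable_eval _) hB, law_succ_eq_bind_next,
      PMF.toMeasure_bind_apply _ _ _ hB,
      ← lintegral_pmf_toMeasure rfl (σ.law n (root A inputs)) (fun v => (σ.next v).toMeasure B),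
      ← ih, lintegral_map measurable_from_top (measurable_eval _)]
    have := σ.pathMeasure_two_steps inputs n Set.univ B
    simp only [Set.mem_univ, true_and, Set.indicator_univ] at this
    exact this

theorem Strategy.pathMeasure_eval_apply (σ : Strategy A) (inputs : Party t → V) (n : ℕ)
    (B : Set (Node A)) :
    σ.pathMeasure inputs {ω | ω n ∈ B} = (σ.law n (root A inputs)).toOuterMeasure B := by
  rw [← PMF.toMeasure_apply_eq_toOuterMeasure_apply _ (measurableSet_node B),
    ← σ.pathMeasure_eval, Measure.map_apply (measurable_eval _) (measurableSet_node B)]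
  rfl

/-- `ω` starts in the root and only uses edges of positive weight. -/
def Strategy.IsPath (σ : Strategy A) (inputs : Party t → V) (ω : ℕ → Node A) : Prop :=
  ω 0 = root A inputs ∧ ∀ k, ω (k + 1) ∈ (σ.next (ω k)).support

/-- There may be uncountably many nodes, so null sets cannot be united over all of them. The law at
each time has countable support, and it is enough to unite over that. -/
theorem Strategy.ae_isPath (σ : Strategy A) (inputs : Party t → V) :
    ∀ᵐ ω ∂(σ.pathMeasure inputs), σ.IsPath inputs ω := by
  have h0 : ∀ᵐ ω ∂(σ.pathMeasure inputs), ω 0 = root A inputs := by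
    have := σ.pathMeasure_eval_apply inputs 0 {root A inputs}ᶜ
    rw [ae_iff]
    refine this.trans ?_
    simp [law]
  have hsupp (n : ℕ) : ∀ᵐ ω ∂(σ.pathMeasure inputs),
      ω n ∈ (σ.law n (root A inputs)).support := by
    have := σ.pathMeasure_eval_apply inputs n (σ.law n (root A inputs)).supportᶜ
    rw [ae_iff]
    refine this.trans ?_
    rw [PMF.toOuterMeasure_apply_eq_zero_iff]
    exact disjoint_compl_right
  have hstep (n : ℕ) (v : Node A) : ∀ᵐ ω ∂(σ.pathMeasure inputs),
      ω n = v → ω (n + 1) ∈ (σ.next v).support := by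
    have := σ.pathMeasure_two_steps inputs n {v} (σ.next v).supportᶜ
    rw [ae_iff]
    have hset : {ω : ℕ → Node A | ¬(ω n = v → ω (n + 1) ∈ (σ.next v).support)} =
        {ω | ω n ∈ ({v} : Set (Node A)) ∧ ω (n + 1) ∈ (σ.next v).supportᶜ} := by
      ext ω; simp
    rw [hset, this]
    refine (lintegral_congr fun ω => ?_).trans lintegral_zero
    by_cases hω : ω n = v
    · rw [Set.indicator_of_mem (by simpa using hω), hω,
        PMF.toMeasure_apply_eq_zero_iff _ (measurableSet_node _)]
      exact disjoint_compl_right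
    · exact Set.indicator_of_notMem (by simpa using hω) _
  have hall : ∀ᵐ ω ∂(σ.pathMeasure inputs), ∀ n, ∀ v ∈ (σ.law n (root A inputs)).support,
      ω n = v → ω (n + 1) ∈ (σ.next v).support := by
    rw [ae_all_iff]
    intro n
    rw [ae_ball_iff (PMF.support_countable _)]
    exact fun v _ => hstep n v
  filter_upwards [h0, ae_all_iff.2 hsupp, hall] with ω h0 h1 h2
  exact ⟨h0, fun k => h2 k (ω k) (h1 k) rfl⟩

/-! ### Growth of configurations along edges -/

/-- The set of parties that have output a decision. -/
def Config.hasDecided (c : Config A) : Set (Party t) := {i | ∃ x, (c.loc i).Decided x}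

/-- The second configuration has the same inputs as the first one and extends its histories. -/
structure Config.Extends (c c' : Config A) : Prop where
  input : ∀ i, (c'.loc i).input = (c.loc i).input
  events : ∀ i, (c.loc i).events <+: (c'.loc i).events
  sent : ∀ i j, c.sent i j <+: c'.sent i j
  delivered : ∀ i j, c.delivered i j ⊆ c'.delivered i j

theorem Config.Extends.refl (c : Config A) : c.Extends c :=
  ⟨fun _ => rfl, fun _ => List.prefix_rfl, fun _ _ => List.prefix_rfl, fun _ _ => subset_rfl⟩

theorem Config.Extends.trans {c c' c'' : Config A} (h : c.Extends c') (h' : c'.Extends c'') :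
    c.Extends c'' :=
  ⟨fun i => (h'.input i).trans (h.input i), fun i => (h.events i).trans (h'.events i),
    fun i j => (h.sent i j).trans (h'.sent i j),
    fun i j => (h.delivered i j).trans (h'.delivered i j)⟩

theorem Config.log_input (c : Config A) (i j : Party t) (e : A.Event) :
    ((c.log i e).loc j).input = (c.loc j).input := by
  by_cases h : j = i
  · subst h; simp [Config.log]
  · simp [Config.log, h]

theorem Config.log_events (c : Config A) (i j : Party t) (e : A.Event) :
    (c.loc j).events <+: ((c.log i e).loc j).events := by
  by_cases h : j = i
  · subst h; simp [Config.log]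
  · simp [Config.log, h]

theorem Config.extends_deliver (c : Config A) (i j : Party t) (m : ℕ) :
    c.Extends (c.deliver i j m) := by
  unfold Config.deliver
  split
  · exact .refl c
  · split
    · exact .refl c
    · refine ⟨fun k => c.log_input j k _, fun k => c.log_events j k _,
        fun _ _ => List.prefix_rfl, fun i' j' => ?_⟩
      dsimp only
      split_ifs with h
      · obtain ⟨rfl, rfl⟩ := h
        exact Finset.subset_insert _ _
      · exact subset_rfl

theorem Config.extends_of_mem_perform (c : Config A) (i : Party t) (a : A.Act) {c' : Config A}
    (h : c' ∈ (c.perform i a).support) : c.Extends c' := by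
  cases a with
  | skip =>
    simp only [perform, PMF.support_pure, Set.mem_singleton_iff] at h
    subst h
    exact ⟨fun k => c.log_input i k _, fun k => c.log_events i k _,
        fun _ _ => List.prefix_rfl, fun i' j' => subset_rfl⟩
  | decide x =>
    simp only [perform, PMF.support_pure, Set.mem_singleton_iff] at h
    subst h
    exact ⟨fun k => c.log_input i k _, fun k => c.log_events i k _,
        fun _ _ => List.prefix_rfl, fun i' j' => subset_rfl⟩
  | send j m =>
    simp only [perform, PMF.support_pure, Set.mem_singleton_iff] at h
    subst h
    refine ⟨fun k => c.log_input i k _, fun k => c.log_events i k _,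
        fun i' j' => ?_, fun i' j' => subset_rfl⟩
    dsimp only
    split_ifs with h
    · obtain ⟨rfl, rfl⟩ := h
      exact List.prefix_append _ _
    · exact List.prefix_rfl
  | access o q =>
    simp only [perform, PMF.support_map, Set.mem_image] at h
    obtain ⟨r, -, rfl⟩ := h
    exact ⟨fun k => c.log_input i k _, fun k => c.log_events i k _,
        fun _ _ => List.prefix_rfl, fun i' j' => subset_rfl⟩

theorem Config.mem_delivered_deliver (c : Config A) (i j : Party t) (m : ℕ)
    (h : m ∈ c.pending i j) : m ∈ (c.deliver i j m).delivered i j := by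
  simp only [Config.pending, Finset.mem_sdiff, Finset.mem_range] at h
  unfold Config.deliver
  rw [List.getElem?_eq_getElem h.1]
  simp [h.2]

theorem Strategy.extends_of_mem_next (σ : Strategy A) {v v' : Node A}
    (h : v' ∈ (σ.next v).support) : v.conf.Extends v'.conf := by
  simp only [next, PMF.support_map, Set.mem_image] at h
  obtain ⟨c', hc', rfl⟩ := h
  unfold nextConf at hc'
  split at hc'
  · exact v.conf.extends_of_mem_perform _ _ hc'
  · rw [PMF.support_pure, Set.mem_singleton_iff] at hc'
    subst hc'
    exact v.conf.extends_deliver _ _ _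

theorem Strategy.length_past_of_mem_next (σ : Strategy A) {v v' : Node A}
    (h : v' ∈ (σ.next v).support) : v'.past.length = v.past.length + 1 := by
  simp only [next, PMF.support_map, Set.mem_image] at h
  obtain ⟨c', hc', rfl⟩ := h
  rfl

/-! ### Stopped runs with pretended inputs -/

/-- The configuration `c` with other inputs. -/
def Config.setInputs (v : Party t → V) (c : Config A) : Config A :=
  { c with loc := fun i => ⟨v i, (c.loc i).events⟩ }

theorem Config.setInputs_log (v : Party t → V) (c : Config A) (i : Party t) (e : A.Event) :
    (c.setInputs v).log i e = (c.log i e).setInputs v := by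
  simp only [Config.log, Config.setInputs, Config.mk.injEq, and_true]
  funext j
  by_cases h : j = i
  · subst h; simp
  · simp [h]

theorem Config.setInputs_deliver (v : Party t → V) (c : Config A) (i j : Party t) (m : ℕ) :
    (c.setInputs v).deliver i j m = (c.deliver i j m).setInputs v := by
  unfold Config.deliver
  change (match (c.sent i j)[m]? with
    | none => _
    | some x => _) = _
  cases (c.sent i j)[m]? with
  | none => rfl
  | some x =>
    dsimp only
    change (if m ∈ c.delivered i j then _ else _) = _
    split_ifs
    · rfl
    · rw [setInputs_log]; rfl

theorem Config.setInputs_perform (v : Party t → V) (c : Config A) (i : Party t) (a : A.Act) :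
    (c.setInputs v).perform i a = (c.perform i a).map (Config.setInputs v) := by
  cases a with
  | skip => simp only [perform, PMF.pure_map, setInputs_log]
  | decide x => simp only [perform, PMF.pure_map, setInputs_log]
  | send j m => simp only [perform, PMF.pure_map, setInputs_log]; rfl
  | access o q => simp only [perform, PMF.map_comp, setInputs_log]; rfl

/-- The law of the next configuration at time `k` if every party `i` runs the algorithm with the
input `w i`, whatever its actual input, and the schedule is `sch`. -/
noncomputable def Config.runNext (w : Party t → V) (sch : ℕ → Set (Party t) → Entry t) (k : ℕ)
    (c : Config A) : PMF (Config A) :=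
  match sch k c.hasDecided with
  | Entry.step i => c.perform i (A.prog i (w i) (c.loc i).events)
  | Entry.deliverOldest i j => PMF.pure (c.deliver i j (sInf (c.pending i j : Set ℕ)))

/-- Actual inputs are never read here: `runNext` passes `w i` to the program, and the other
ingredients of a step only use histories, links and objects. -/
theorem Config.setInputs_runNext (w : Party t → V) (sch : ℕ → Set (Party t) → Entry t) (k : ℕ)
    (v : Party t → V) (c : Config A) :
    (c.setInputs v).runNext w sch k = (c.runNext w sch k).map (Config.setInputs v) := by
  unfold Config.runNext
  change (match sch k c.hasDecided with
    | Entry.step i => _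
    | Entry.deliverOldest i j => _) = _
  cases sch k c.hasDecided with
  | step i => exact setInputs_perform v c i _
  | deliverOldest i j =>
    dsimp only
    rw [PMF.pure_map, setInputs_deliver]
    rfl

/-- The configurations in which every party outside `D` has decided. -/
def doneOutside (A : Algorithm.{u, w} t V) (D : Finset (Party t)) : Set (Config A) :=
  {c | ∀ i, i ∉ D → i ∈ c.hasDecided}

open Classical in
/-- The law of the configuration after `n` steps from time `k` on, if every party `i` runs the
algorithm with input `w i` and the run is stopped once all parties outside `D` have decided. -/
noncomputable def Config.stoppedLaw (w : Party t → V) (sch : ℕ → Set (Party t) → Entry t)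
    (D : Finset (Party t)) : ℕ → ℕ → Config A → PMF (Config A)
  | 0, _, c => PMF.pure c
  | n + 1, k, c =>
    if c ∈ doneOutside A D then PMF.pure c
    else (c.runNext w sch k).bind (Config.stoppedLaw w sch D n (k + 1))

theorem Config.setInputs_stoppedLaw (w : Party t → V) (sch : ℕ → Set (Party t) → Entry t)
    (D : Finset (Party t)) (v : Party t → V) (n k : ℕ) (c : Config A) :
    (c.setInputs v).stoppedLaw w sch D n k = (c.stoppedLaw w sch D n k).map (setInputs v) := by
  induction n generalizing k c with
  | zero => simp only [stoppedLaw, PMF.pure_map]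
  | succ n ih =>
    have hd : c.setInputs v ∈ doneOutside A D ↔ c ∈ doneOutside A D := Iff.rfl
    by_cases hc : c ∈ doneOutside A D
    · rw [stoppedLaw, stoppedLaw, if_pos hc, if_pos (hd.2 hc), PMF.pure_map]
    · rw [stoppedLaw, stoppedLaw, if_neg hc, if_neg (mt hd.1 hc), setInputs_runNext,
        PMF.bind_map, PMF.map_bind]
      congr 1
      funext c'
      exact ih _ c'

/-- The schedule never lets a party of `D` take a step before all the others have decided. -/
def Delays (sch : ℕ → Set (Party t) → Entry t) (D : Finset (Party t)) : Prop :=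
  ∀ k s i, sch k s = Entry.step i → i ∈ D → ∀ j, j ∉ D → j ∈ s

/-- This is the indistinguishability: before the stop no party of `D` takes a step, so what the
program would do with its input is never consulted. -/
theorem Config.stoppedLaw_congr {w w' : Party t → V} {sch : ℕ → Set (Party t) → Entry t}
    {D : Finset (Party t)} (hsch : Delays sch D) (hw : ∀ i, i ∉ D → w i = w' i) (n k : ℕ)
    (c : Config A) : c.stoppedLaw w sch D n k = c.stoppedLaw w' sch D n k := by
  induction n generalizing k c with
  | zero => rfl
  | succ n ih =>
    simp only [stoppedLaw]
    split_ifs with hd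
    · rfl
    · have hrun : c.runNext w sch k = c.runNext w' sch k := by
        unfold Config.runNext
        cases h : sch k c.hasDecided with
        | step i =>
          dsimp only
          rw [hw i fun hi => hd (hsch k _ i h hi)]
        | deliverOldest i j => rfl
      rw [hrun, funext (ih (k + 1))]

/-- The set `B` of configurations is preserved if the local histories are extended. -/
def HistoryMono (B : Set (Config A)) : Prop :=
  ∀ c c' : Config A, (∀ i, (c.loc i).events <+: (c'.loc i).events) → c ∈ B → c' ∈ B

theorem HistoryMono.preimage_setInputs {B : Set (Config A)} (hB : HistoryMono B)
    (v : Party t → V) : Config.setInputs v ⁻¹' B = B := by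
  ext c
  exact ⟨hB _ _ fun _ => List.prefix_rfl, hB _ _ fun _ => List.prefix_rfl⟩

theorem historyMono_doneOutside (D : Finset (Party t)) : HistoryMono (doneOutside A D) := by
  intro c c' h hc i hi
  obtain ⟨x, hx⟩ := hc i hi
  exact ⟨x, (h i).subset hx⟩

/-- The probability that the stopped run of `n` steps is in `B`. -/
noncomputable def stoppedProb (A : Algorithm.{u, w} t V) (w : Party t → V)
    (sch : ℕ → Set (Party t) → Entry t)
    (D : Finset (Party t)) (n : ℕ) (B : Set (Config A)) : ENNReal :=
  ((Config.init A w).stoppedLaw w sch D n 0).toOuterMeasure B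

/-- Both the pretended inputs on `D` and all the actual inputs may be changed, because `B` only
looks at the histories. -/
theorem stoppedProb_congr {w w' : Party t → V} {sch : ℕ → Set (Party t) → Entry t}
    {D : Finset (Party t)} (hsch : Delays sch D) (hw : ∀ i, i ∉ D → w i = w' i) (n : ℕ)
    {B : Set (Config A)} (hB : HistoryMono B) (v : Party t → V) :
    ((Config.init A v).stoppedLaw w' sch D n 0).toOuterMeasure B =
      stoppedProb A w sch D n B := by
  have : Config.init A v = (Config.init A w).setInputs v := rfl
  rw [this, Config.setInputs_stoppedLaw, PMF.toOuterMeasure_map_apply, hB.preimage_setInputs,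
    stoppedProb, Config.stoppedLaw_congr hsch hw]

/-! ### Comparison of the execution tree with the stopped run -/

/-- The scheduling of the strategy `σ` is `sch`, and every party `i` runs the algorithm
with the input `w i`, provided that the actual inputs of the honest parties are these. -/
def Strategy.Runs (σ : Strategy A) (w : Party t → V) (sch : ℕ → Set (Party t) → Entry t) : Prop :=
  ∀ v : Node A, (∀ i, i ∉ σ.corrupted → (v.conf.loc i).input = w i) →
    σ.nextConf v = v.conf.runNext w sch v.past.length

theorem elementaryStrategy_runs (C : Finset (Party t)) (hC : C.card ≤ t)
    (w : Party t → V) (len : ℕ) (table : Fin (len + 1) → Set (Party t) → Entry t) :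
    (elementaryStrategy A C hC (fun i => some (w i)) len table).Runs w
      (fun k => table (Fin.ofNat (len + 1) k)) := by
  intro v hv
  unfold Strategy.nextConf Config.runNext
  have hch : (elementaryStrategy A C hC (fun i => some (w i)) len table).choice v =
      match table (Fin.ofNat (len + 1) v.past.length) v.conf.hasDecided with
      | Entry.step i => Sched.step i
      | Entry.deliverOldest i j => Sched.deliver i j (sInf (v.conf.pending i j : Set ℕ)) := rfl
  rw [hch]
  dsimp only
  cases table (Fin.ofNat (len + 1) v.past.length) v.conf.hasDecided with
  | deliverOldest i j => rfl
  | step i =>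
    dsimp only
    by_cases hi : i ∈ C
    · rw [if_pos (by exact hi)]
      simp [elementaryStrategy, Config.observe, hi]
    · rw [if_neg (by exact hi), hv i hi]

/-- A coupling: the two processes agree until the stop, and afterwards the tree can only extend
histories, which does not leave `B`. Equality may fail, since `B` may be entered after the stop. -/
theorem Strategy.stoppedLaw_le_law {σ : Strategy A} {w : Party t → V}
    {sch : ℕ → Set (Party t) → Entry t} (hσ : σ.Runs w sch) (D : Finset (Party t))
    {B : Set (Config A)} (hB : HistoryMono B) (n : ℕ)
    (v : Node A) (hv : ∀ i, i ∉ σ.corrupted → (v.conf.loc i).input = w i) :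
    (v.conf.stoppedLaw w sch D n v.past.length).toOuterMeasure B ≤
      (σ.law n v).toOuterMeasure (Node.conf ⁻¹' B) := by
  induction n generalizing v with
  | zero =>
    simp only [Config.stoppedLaw, law, PMF.toOuterMeasure_pure_apply]
    by_cases h : v.conf ∈ B
    · rw [if_pos h, if_pos (by exact h)]
    · rw [if_neg h, if_neg (by exact h)]
  | succ n ih =>
    by_cases hd : v.conf ∈ doneOutside A D
    · rw [Config.stoppedLaw, if_pos hd, PMF.toOuterMeasure_pure_apply]
      split_ifs with hvB
      · refine ge_of_eq ?_
        rw [PMF.toOuterMeasure_apply_eq_one_iff]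
        -- From here on the stopped run is frozen, and an induction on the number of remaining steps
        -- shows that the tree stays in `B`.
        generalize n + 1 = m
        clear hd ih hv
        induction m generalizing v with
        | zero => simpa [law] using hvB
        | succ m ihm =>
          intro v' hv'
          rw [law, PMF.mem_support_bind_iff] at hv'
          obtain ⟨u, hu, hv'⟩ := hv'
          exact ihm u (hB _ _ (σ.extends_of_mem_next hu).events hvB) hv'
      · exact zero_le
    · rw [Config.stoppedLaw, if_neg hd, law, next, PMF.bind_map, hσ v hv,
        PMF.toOuterMeasure_bind_apply, PMF.toOuterMeasure_bind_apply]
      refine ENNReal.tsum_le_tsum fun c => ?_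
      by_cases hc : c ∈ (v.conf.runNext w sch v.past.length).support
      · have hmem : (⟨v.conf.observe σ.corrupted :: v.past, c⟩ : Node A) ∈ (σ.next v).support := by
          rw [next, PMF.mem_support_map_iff]
          exact ⟨c, by rwa [hσ v hv], rfl⟩
        have hin := (σ.extends_of_mem_next hmem).input
        gcongr
        exact ih ⟨v.conf.observe σ.corrupted :: v.past, c⟩ fun i hi => (hin i).trans (hv i hi)
      · rw [← PMF.apply_eq_zero_iff] at hc
        simp [hc]

/-- For the stopping set itself the comparison can be reversed: a stopped run has reached it, and an
unstopped one still follows the tree. -/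
theorem Strategy.law_done_le_stoppedLaw {σ : Strategy A} {w : Party t → V}
    {sch : ℕ → Set (Party t) → Entry t} (hσ : σ.Runs w sch) (D : Finset (Party t)) (n : ℕ)
    (v : Node A) (hv : ∀ i, i ∉ σ.corrupted → (v.conf.loc i).input = w i) :
    (σ.law n v).toOuterMeasure (Node.conf ⁻¹' doneOutside A D) ≤
      (v.conf.stoppedLaw w sch D n v.past.length).toOuterMeasure (doneOutside A D) := by
  induction n generalizing v with
  | zero =>
    simp only [Config.stoppedLaw, law, PMF.toOuterMeasure_pure_apply]
    by_cases h : v.conf ∈ doneOutside A D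
    · rw [if_pos h, if_pos (by exact h)]
    · rw [if_neg h, if_neg (by exact h)]
  | succ n ih =>
    by_cases hd : v.conf ∈ doneOutside A D
    · rw [Config.stoppedLaw, if_pos hd, PMF.toOuterMeasure_pure_apply, if_pos hd]
      exact (measure_mono (Set.subset_univ _)).trans
        (((σ.law (n + 1) v).toOuterMeasure_apply_eq_one_iff _).2 (Set.subset_univ _)).le
    · rw [Config.stoppedLaw, if_neg hd, law, next, PMF.bind_map, hσ v hv,
        PMF.toOuterMeasure_bind_apply, PMF.toOuterMeasure_bind_apply]
      refine ENNReal.tsum_le_tsum fun c => ?_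
      by_cases hc : c ∈ (v.conf.runNext w sch v.past.length).support
      · have hmem : (⟨v.conf.observe σ.corrupted :: v.past, c⟩ : Node A) ∈ (σ.next v).support := by
          rw [next, PMF.mem_support_map_iff]
          exact ⟨c, by rwa [hσ v hv], rfl⟩
        have hin := (σ.extends_of_mem_next hmem).input
        gcongr
        exact ih ⟨v.conf.observe σ.corrupted :: v.past, c⟩ fun i hi => (hin i).trans (hv i hi)
      · rw [← PMF.apply_eq_zero_iff] at hc
        simp [hc]

/-! ### Delaying schedules and their fairness -/

theorem exists_surjective_entry (t : ℕ) :
    ∃ (len : ℕ) (base : Fin (len + 1) → Entry t), Function.Surjective base := by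
  let f : Party t ⊕ (Party t × Party t) → Entry t :=
    Sum.elim Entry.step fun p => Entry.deliverOldest p.1 p.2
  have hf : Function.Surjective f := by
    rintro (i | ⟨i, j⟩)
    · exact ⟨Sum.inl i, rfl⟩
    · exact ⟨Sum.inr (i, j), rfl⟩
  obtain ⟨n, ⟨e⟩⟩ := Finite.exists_equiv_fin (Party t ⊕ (Party t × Party t))
  obtain ⟨len, rfl⟩ : ∃ len, n = len + 1 :=
    Nat.exists_eq_succ_of_ne_zero (Fin.pos (e (Sum.inl 0))).ne'
  exact ⟨len, f ∘ e.symm, hf.comp e.symm.surjective⟩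

open Classical in
/-- The scheduling table that goes through the entries of `base`, but lets no party of `D` take a
step before all the others have decided. -/
noncomputable def delayTable (D : Finset (Party t)) {len : ℕ} (base : Fin (len + 1) → Entry t)
    (k : Fin (len + 1)) (s : Set (Party t)) : Entry t :=
  match base k with
  | Entry.step i =>
    -- A forbidden step is replaced by a delivery on the link of the party to itself. If nothing is
    -- pending there, `sInf ∅ = 0` makes this a void delivery.
    if i ∈ D ∧ ¬ ∀ j, j ∉ D → j ∈ s then Entry.deliverOldest i i else Entry.step i
  | Entry.deliverOldest i j => Entry.deliverOldest i j

/-- The time-dependent schedule of `delayTable`. -/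
noncomputable abbrev delaySched (D : Finset (Party t)) {len : ℕ} (base : Fin (len + 1) → Entry t)
    (k : ℕ) : Set (Party t) → Entry t :=
  delayTable D base (Fin.ofNat (len + 1) k)

theorem delays_delaySched (D : Finset (Party t)) {len : ℕ} (base : Fin (len + 1) → Entry t) :
    Delays (delaySched D base) D := by
  intro k s i h hi
  simp only [delayTable] at h
  split at h
  · split_ifs at h with h'
    obtain rfl := Entry.step.inj h
    by_contra hc
    exact h' ⟨hi, hc⟩
  · cases h

/-- The parties in `C` are corrupted and run the algorithm as if their inputs were given by `w`,
and the parties in `D` are delayed until all the others have decided. -/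
noncomputable def delayStrategy (A : Algorithm.{u, w} t V) (C : Finset (Party t)) (hC : C.card ≤ t)
    (w : Party t → V) (D : Finset (Party t)) {len : ℕ} (base : Fin (len + 1) → Entry t) :
    Strategy A :=
  elementaryStrategy A C hC (fun i => some (w i)) len (delayTable D base)

theorem delayStrategy_runs (C : Finset (Party t)) (hC : C.card ≤ t)
    (w : Party t → V) (D : Finset (Party t)) {len : ℕ} (base : Fin (len + 1) → Entry t) :
    (delayStrategy A C hC w D base).Runs w (delaySched D base) :=
  elementaryStrategy_runs C hC w len (delayTable D base)

/-- The table is indexed by `past.length`; along a path this is the time. -/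
theorem Strategy.IsPath.length_past {σ : Strategy A} {inputs : Party t → V} {ω : ℕ → Node A}
    (h : σ.IsPath inputs ω) (k : ℕ) : (ω k).past.length = k := by
  induction k with
  | zero => rw [h.1]; rfl
  | succ k ih => rw [σ.length_past_of_mem_next (h.2 k), ih]

theorem Strategy.IsPath.extends {σ : Strategy A} {inputs : Party t → V} {ω : ℕ → Node A}
    (h : σ.IsPath inputs ω) {k k' : ℕ} (hk : k ≤ k') : (ω k).conf.Extends (ω k').conf := by
  induction k', hk using Nat.le_induction with
  | base => exact .refl _
  | succ k' _ ih => exact ih.trans (σ.extends_of_mem_next (h.2 k'))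

theorem Strategy.IsPath.decided_mono {σ : Strategy A} {inputs : Party t → V} {ω : ℕ → Node A}
    (h : σ.IsPath inputs ω) {k k' : ℕ} (hk : k ≤ k') {i : Party t} {x : V}
    (hx : ((ω k).conf.loc i).Decided x) : ((ω k').conf.loc i).Decided x :=
  ((h.extends hk).events i).subset hx

theorem exists_ge_ofNat_eq (len : ℕ) (r : Fin (len + 1)) (K : ℕ) :
    ∃ k ≥ K, Fin.ofNat (len + 1) k = r := by
  refine ⟨r + (len + 1) * K, by nlinarith, Fin.ext ?_⟩
  simp [Fin.ofNat, Nat.mod_eq_of_lt r.2]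

section Fairness

variable {C : Finset (Party t)} {hC : C.card ≤ t} {w : Party t → V} {D : Finset (Party t)}
  {len : ℕ} {base : Fin (len + 1) → Entry t} {inputs : Party t → V} {ω : ℕ → Node A}

theorem delayStrategy_choice (hω : (delayStrategy A C hC w D base).IsPath inputs ω) (k : ℕ) :
    (delayStrategy A C hC w D base).choice (ω k) =
      match delayTable D base (Fin.ofNat (len + 1) k) (ω k).conf.hasDecided with
      | Entry.step i => Sched.step i
      | Entry.deliverOldest i j => Sched.deliver i j (sInf ((ω k).conf.pending i j : Set ℕ)) := by
  have h : (delayStrategy A C hC w D base).choice (ω k) =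
      match delayTable D base (Fin.ofNat (len + 1) (ω k).past.length) (ω k).conf.hasDecided with
      | Entry.step i => Sched.step i
      | Entry.deliverOldest i j => Sched.deliver i j (sInf ((ω k).conf.pending i j : Set ℕ)) := rfl
  rw [h, hω.length_past k]

theorem exists_ge_conf_eq_deliver (hbase : Function.Surjective base)
    (hω : (delayStrategy A C hC w D base).IsPath inputs ω) (i j : Party t) (K : ℕ) :
    ∃ k ≥ K, (ω (k + 1)).conf =
      (ω k).conf.deliver i j (sInf ((ω k).conf.pending i j : Set ℕ)) := by
  obtain ⟨r, hr⟩ := hbase (Entry.deliverOldest i j)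
  obtain ⟨k, hk, hkr⟩ := exists_ge_ofNat_eq len r K
  refine ⟨k, hk, ?_⟩
  have hch := delayStrategy_choice hω k
  simp only [hkr, delayTable, hr] at hch
  have h := hω.2 k
  rw [Strategy.next, PMF.mem_support_map_iff] at h
  obtain ⟨c, hc, h⟩ := h
  rw [Strategy.nextConf, hch, PMF.support_pure, Set.mem_singleton_iff] at hc
  rw [← h, hc]

/-- Deliveries are made oldest first: once all smaller indices have been delivered, the next visit
of the table to this link delivers `m`, unless that has already happened. -/
theorem exists_mem_delivered (hbase : Function.Surjective base)
    (hω : (delayStrategy A C hC w D base).IsPath inputs ω) (i j : Party t) (m k : ℕ)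
    (hm : m < ((ω k).conf.sent i j).length) : ∃ k', m ∈ (ω k').conf.delivered i j := by
  induction m using Nat.strong_induction_on with
  | _ m ih =>
  -- The inner induction gathers the finitely many delivery times of the smaller indices into one
  -- time `K`.
  have hK : ∀ n ≤ m, ∃ K ≥ k, ∀ m' < n, m' ∈ (ω K).conf.delivered i j := by
    intro n hn
    induction n with
    | zero => exact ⟨k, le_rfl, fun _ h => absurd h (Nat.not_lt_zero _)⟩
    | succ n ihn =>
      obtain ⟨K, hK, hKn⟩ := ihn (by omega)
      obtain ⟨K', hK'⟩ := ih n (by omega) (by omega)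
      refine ⟨max K K', le_max_of_le_left hK, fun m' hm' => ?_⟩
      rcases Nat.lt_succ_iff_lt_or_eq.1 hm' with h | rfl
      · exact (hω.extends (le_max_left K K')).delivered i j (hKn m' h)
      · exact (hω.extends (le_max_right K K')).delivered i j hK'
  obtain ⟨K, hK, hKm⟩ := hK m le_rfl
  obtain ⟨k', hk', hdel⟩ := exists_ge_conf_eq_deliver hbase hω i j K
  by_cases hmd : m ∈ (ω k').conf.delivered i j
  · exact ⟨k', hmd⟩
  have hpend : m ∈ (ω k').conf.pending i j := by
    simp only [Config.pending, Finset.mem_sdiff, Finset.mem_range]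
    exact ⟨hm.trans_le ((hω.extends (hK.trans hk')).sent i j).length_le, hmd⟩
  have hmem : sInf ((ω k').conf.pending i j : Set ℕ) ∈ (ω k').conf.pending i j :=
    Finset.mem_coe.1 (Nat.sInf_mem ⟨m, Finset.mem_coe.2 hpend⟩)
  have hinf : sInf ((ω k').conf.pending i j : Set ℕ) = m := by
    refine le_antisymm (Nat.sInf_le (Finset.mem_coe.2 hpend)) (not_lt.1 fun hlt => ?_)
    have h1 := (hω.extends hk').delivered i j (hKm _ hlt)
    simp only [Config.pending, Finset.mem_sdiff] at hmem
    exact hmem.2 h1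
  refine ⟨k' + 1, ?_⟩
  rw [hdel, hinf]
  exact (ω k').conf.mem_delivered_deliver i j m hpend

/-- The strategy is fair on paths on which the delay ends, and also if only corrupted parties
are delayed. -/
theorem delayStrategy_fair (hbase : Function.Surjective base)
    (hω : (delayStrategy A C hC w D base).IsPath inputs ω)
    (hD : D ⊆ C ∨ ∃ k, (ω k).conf ∈ doneOutside A D) :
    (delayStrategy A C hC w D base).Fair ω := by
  refine ⟨fun i hi K => ?_, fun i j k m hm => ?_⟩
  · obtain ⟨r, hr⟩ := hbase (Entry.step i)
    -- From time `K'` on, the table no longer blocks party `i`.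
    obtain ⟨K', hKK', hK'⟩ : ∃ K' ≥ K, i ∉ D ∨ (ω K').conf ∈ doneOutside A D := by
      rcases hD with h | ⟨k, hk⟩
      · exact ⟨K, le_rfl, .inl fun h' => hi (h h')⟩
      · exact ⟨max K k, le_max_left _ _, .inr (historyMono_doneOutside D _ _
          (hω.extends (le_max_right _ _)).events hk)⟩
    obtain ⟨k, hk, hkr⟩ := exists_ge_ofNat_eq len r K'
    refine ⟨k, hKK'.trans hk, ?_⟩
    have hnot : ¬ (i ∈ D ∧ ¬ ∀ j, j ∉ D → j ∈ (ω k).conf.hasDecided) := by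
      rintro ⟨hiD, hnd⟩
      refine hK'.elim (fun h => h hiD) fun h => hnd ?_
      exact historyMono_doneOutside D _ _ (hω.extends hk).events h
    rw [delayStrategy_choice hω k, hkr, delayTable, hr]
    dsimp only
    rw [if_neg hnot]
  · simp only [Config.pending, Finset.mem_sdiff, Finset.mem_range] at hm
    exact exists_mem_delivered hbase hω i j m k hm.1

end Fairness

/-! ### Balanced arrangements of the inputs -/

theorem exists_map_univ_eq {n : ℕ} (M : Multiset V) (hM : M.card = n) :
    ∃ v : Fin n → V, Finset.univ.val.map v = M := by
  induction M using Quotient.inductionOn with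
  | _ l =>
  have hl : l.length = n := hM
  subst hl
  exact ⟨l.get, by rw [Fin.univ_val_map, List.ofFn_get]; rfl⟩

open Classical in
theorem count_le_maxMult (M : Multiset V) (a : V) : M.count a ≤ maxMult M := by
  by_cases ha : a ∈ M
  · unfold maxMult
    exact Finset.le_sup (f := fun x => M.count x) (Multiset.mem_toFinset.2 ha)
  · simp [Multiset.count_eq_zero_of_notMem ha]

open Classical in
/-- If no value is taken more than `2t + f` times, then `2t + 1 - f` parties can be chosen
such that among them no value is taken more than `t` times. -/
theorem exists_balanced (f : ℕ) (hf : 1 ≤ f) (v : Party t → V)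
    (hv : ∀ a, (Finset.univ.filter fun i => v i = a).card ≤ 2 * t + f) :
    ∃ R : Finset (Party t), R.card = 2 * t + 1 - f ∧ ∀ a, (R.filter fun i => v i = a).card ≤ t := by
  -- A largest balanced set is big enough; a subset of it then has the exact size.
  obtain ⟨R, hR, hmax⟩ := Finset.exists_max_image
    (Finset.univ.filter fun R : Finset (Party t) => ∀ a, (R.filter fun i => v i = a).card ≤ t)
    Finset.card ⟨∅, by simp⟩
  simp only [Finset.mem_filter, Finset.mem_univ, true_and] at hR hmax
  suffices h : 2 * t + 1 - f ≤ R.card by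
    obtain ⟨R', hR', hcard⟩ := Finset.exists_subset_card_eq h
    exact ⟨R', hcard, fun a => (Finset.card_le_card (Finset.filter_subset_filter _ hR')).trans
      (hR a)⟩
  by_contra! hlt
  -- By maximality, the value of each party outside `R` is already taken `t` times in `R`.
  have hfull : ∀ i, i ∉ R → (R.filter fun j => v j = v i).card = t := by
    intro i hi
    by_contra hne
    have hlt' : (R.filter fun j => v j = v i).card < t := lt_of_le_of_ne (hR _) hne
    have hle := hmax (insert i R) fun a => by
      rw [Finset.filter_insert]
      split_ifs with h
      · subst h
        exact (Finset.card_insert_le _ _).trans hlt'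
      · exact hR a
    rw [Finset.card_insert_of_notMem hi] at hle
    omega
  have hcompl : Rᶜ.card = 3 * t + 1 - R.card := by
    rw [Finset.card_compl, Fintype.card_fin]
  obtain ⟨i, hi⟩ : Rᶜ.Nonempty := Finset.card_pos.1 (by omega)
  rw [Finset.mem_compl] at hi
  -- If only one value occurs outside `R`, it is taken `t + (3t + 1 - |R|) > 2t + f` times in all.
  -- If two occur, then `|R| ≥ 2t`, which contradicts `|R| < 2t + 1 - f` because `f ≥ 1`.
  by_cases hone : ∀ j, j ∉ R → v j = v i
  · have hsub : (R.filter fun j => v j = v i) ∪ Rᶜ ⊆ Finset.univ.filter fun j => v j = v i := by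
      intro j hj
      simp only [Finset.mem_union, Finset.mem_filter, Finset.mem_compl] at hj
      simp only [Finset.mem_filter, Finset.mem_univ, true_and]
      exact hj.elim (fun h => h.2) (hone j)
    have hdisj : Disjoint (R.filter fun j => v j = v i) Rᶜ :=
      (disjoint_compl_right (a := R)).mono_left (Finset.filter_subset _ _)
    have h1 := Finset.card_le_card hsub
    rw [Finset.card_union_of_disjoint hdisj, hfull i hi, hcompl] at h1
    have h2 := hv (v i)
    omega
  · push Not at hone
    obtain ⟨j, hj, hne⟩ := hone
    have hdisj : Disjoint (R.filter fun k => v k = v i) (R.filter fun k => v k = v j) := by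
      rw [Finset.disjoint_filter]
      exact fun k _ h h' => hne (h'.symm.trans h)
    have h1 := Finset.card_le_card (Finset.union_subset (Finset.filter_subset (fun k => v k = v i) R)
      (Finset.filter_subset (fun k => v k = v j) R))
    rw [Finset.card_union_of_disjoint hdisj, hfull i hi, hfull j hj] at h1
    omega

open Classical in
theorem exists_balanced_arrangement (f : ℕ) (hf : 1 ≤ f) (hft : f ≤ t) (M : Multiset V)
    (hM : M.card = 3 * t + 1) (hmult : maxMult M ≤ 2 * t + f) :
    ∃ (v : Party t → V) (C D : Finset (Party t)), Finset.univ.val.map v = M ∧ C.card = f ∧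
      D.card = t ∧ Disjoint C D ∧
      ∀ a, (Finset.univ.filter fun i => i ∉ C ∧ i ∉ D ∧ v i = a).card ≤ t := by
  obtain ⟨v, hv⟩ := exists_map_univ_eq M hM
  obtain ⟨R, hR, hRa⟩ := exists_balanced f hf v fun a => by
    refine le_trans ?_ ((count_le_maxMult M a).trans hmult)
    rw [← hv, Multiset.count_map, Finset.card_def, Finset.filter_val]
    simp only [eq_comm, le_refl]
  have hcompl : Rᶜ.card = t + f := by
    rw [Finset.card_compl, Fintype.card_fin]
    omega
  obtain ⟨C, hC, hCf⟩ := Finset.exists_subset_card_eq (show f ≤ Rᶜ.card by omega)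
  refine ⟨v, C, Rᶜ \ C, hv, hCf, ?_, Finset.disjoint_sdiff, fun a => ?_⟩
  · rw [Finset.card_sdiff_of_subset hC]; omega
  · refine (Finset.card_le_card fun i hi => ?_).trans (hRa a)
    simp only [Finset.mem_filter, Finset.mem_univ, true_and, Finset.mem_sdiff,
      Finset.mem_compl] at hi ⊢
    refine ⟨?_, hi.2.2⟩
    by_contra h
    exact hi.2.1 ⟨h, hi.1⟩

/-! ### Limits, measurability and the uniform validity bound -/

/-- The probability of being in a history-monotone set at time `n` tends to the probability of
ever being in it. -/
theorem Strategy.tendsto_pathMeasure (σ : Strategy A) (inputs : Party t → V)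
    {B : Set (Config A)} (hB : HistoryMono B) :
    Filter.Tendsto (fun n => σ.pathMeasure inputs {ω | (ω n).conf ∈ B}) Filter.atTop
      (nhds (σ.pathMeasure inputs {ω | ∃ n, (ω n).conf ∈ B})) := by
  have h := tendsto_measure_iUnion_accumulate (μ := σ.pathMeasure inputs)
    (f := fun n => {ω : ℕ → Node A | (ω n).conf ∈ B}) (ι := ℕ)
  have hU : (⋃ n, {ω : ℕ → Node A | (ω n).conf ∈ B}) = {ω | ∃ n, (ω n).conf ∈ B} := by
    ext ω; simp
  rw [hU] at h
  refine h.congr fun n => measure_congr ?_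
  filter_upwards [σ.ae_isPath inputs] with ω hω
  refine propext ⟨fun hacc => ?_, fun hn => ?_⟩
  · obtain ⟨k, hk, hkB⟩ := Set.mem_accumulate.1 hacc
    exact hB _ _ (hω.extends hk).events hkB
  · exact Set.mem_accumulate.2 ⟨n, le_rfl, hn⟩

theorem stoppedProb_le_one (w : Party t → V) (sch : ℕ → Set (Party t) → Entry t)
    (D : Finset (Party t)) (n : ℕ) (B : Set (Config A)) : stoppedProb A w sch D n B ≤ 1 :=
  (measure_mono (Set.subset_univ B)).trans
    ((PMF.toOuterMeasure_apply_eq_one_iff _ _).2 (Set.subset_univ _)).le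

theorem Ensemble.measurableSet_decidesInput (E : Ensemble A) :
    MeasurableSet {ω : ℕ → Node A | ∀ i, E.Honest i → ∃ x ∈ E.inputMultiset, Decides ω i x} := by
  have : {ω : ℕ → Node A | ∀ i, E.Honest i → ∃ x ∈ E.inputMultiset, Decides ω i x} =
      ⋂ i, ⋂ (_ : E.Honest i), ⋃ k : ℕ,
        {ω | ω k ∈ {v : Node A | ∃ x ∈ E.inputMultiset, (v.conf.loc i).Decided x}} := by
    ext ω
    simp only [Decides, Set.mem_ofPred_eq, Set.mem_iInter, Set.mem_iUnion]
    refine forall₂_congr fun i _ => ⟨?_, ?_⟩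
    · rintro ⟨x, hx, k, hk⟩
      exact ⟨k, x, hx, hk⟩
    · rintro ⟨k, x, hx, hk⟩
      exact ⟨x, hx, k, hk⟩
  rw [this]
  exact .iInter fun i => .iInter fun _ => .iUnion fun k => measurableSet_eval k _

theorem Ensemble.probDecidesInput_le_one (E : Ensemble A) : E.probDecidesInput ≤ 1 :=
  measureReal_le_one

theorem Ensemble.ae_isPath (E : Ensemble A) : ∀ᵐ ω ∂E.prob, E.IsPath ω :=
  E.strategy.ae_isPath E.inputs

variable {Adv : AdversaryClass.{u, w} t V}

/-- Under Qualitative Validity and Probabilistic Termination the bound of the second case holds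
in the first case, too. -/
theorem Ensemble.le_probDecidesInput (hterm : ProbTermination Adv A)
    (hval : QualitativeValidity Adv A) (E : Ensemble A) (hE : E.strategy ∈ Adv A) :
    1 - (E.numCorrupted : ℝ) / ((3 * t + 1 : ℝ) - t) ≤ E.probDecidesInput := by
  obtain ⟨h1, h2⟩ := hval E hE
  rcases lt_or_ge ((maxMult E.inputMultiset : ℤ) - E.numCorrupted) (2 * t + 1 : ℤ) with h | h
  · exact h2 h
  · have hall := h1 h
    have hone : E.probDecidesInput = 1 := by
      have hae : ∀ᵐ ω ∂E.prob, ∀ i, E.Honest i → ∃ x, Decides ω i x :=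
        ae_all_iff.2 fun i => ae_all_iff.2 fun hi => hterm E hE i hi
      have : E.prob {ω | ∀ i, E.Honest i → ∃ x ∈ E.inputMultiset, Decides ω i x} = 1 := by
        rw [← mem_ae_iff_prob_eq_one E.measurableSet_decidesInput]
        filter_upwards [hae, E.ae_isPath] with ω hω hpath i hi
        obtain ⟨x, hx⟩ := hω i hi
        exact ⟨x, hall ω hpath i hi x hx, hx⟩
      rw [probDecidesInput, measureReal_def, this, ENNReal.toReal_one]
    rw [hone]
    have : 0 ≤ (E.numCorrupted : ℝ) / ((3 * t + 1 : ℝ) - t) :=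
      div_nonneg (Nat.cast_nonneg _) (by linarith [(Nat.cast_nonneg t : (0 : ℝ) ≤ t)])
    linarith

theorem delayStrategy_mem (hAdv : CanRunAlgorithm Adv) (C : Finset (Party t)) (hC : C.card ≤ t)
    (w : Party t → V) (D : Finset (Party t)) {len : ℕ} (base : Fin (len + 1) → Entry t) :
    delayStrategy A C hC w D base ∈ Adv A :=
  hAdv A C hC _ len _

/-! ### Transfer between ensembles that share a stopped run -/

section Delayed

variable {D : Finset (Party t)} {len : ℕ} {base : Fin (len + 1) → Entry t}

/-- Almost surely the stopped run is eventually stopped. -/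
theorem tendsto_stoppedProb_doneOutside (hAdv : CanRunAlgorithm Adv)
    (hterm : ProbTermination Adv A) (hbase : Function.Surjective base) (hD : D.card ≤ t)
    (w : Party t → V) :
    Filter.Tendsto (fun n => stoppedProb A w (delaySched D base) D n (doneOutside A D))
      Filter.atTop (nhds 1) := by
  -- The delayed parties are themselves the corrupted ones, so fairness does not presuppose that the
  -- delay ends, and Termination can be applied.
  let σ := delayStrategy A D hD w D base
  let E : Ensemble A := ⟨w, σ, by
    filter_upwards [σ.ae_isPath w] with ω hω
    exact delayStrategy_fair hbase hω (.inl subset_rfl)⟩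
  have hall : ∀ᵐ ω ∂E.prob, ∀ i, i ∉ D → ∃ x, Ensemble.Decides ω i x :=
    ae_all_iff.2 fun i => ae_all_iff.2 fun hi => hterm E (delayStrategy_mem hAdv _ _ _ _ _) i hi
  have hdone : ∀ᵐ ω ∂E.prob, ∃ n, (ω n).conf ∈ doneOutside A D := by
    filter_upwards [hall, E.ae_isPath] with ω hω hpath
    have : Nonempty V := ⟨w 0⟩
    choose! x k hk using hω
    refine ⟨Finset.univ.sup k, fun i hi => ⟨x i, ?_⟩⟩
    exact Strategy.IsPath.decided_mono (σ := σ) (inputs := w) hpath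
      (Finset.le_sup (Finset.mem_univ i)) (hk i hi)
  have hlim := σ.tendsto_pathMeasure w (historyMono_doneOutside (A := A) D)
  have hone : σ.pathMeasure w {ω | ∃ n, (ω n).conf ∈ doneOutside A D} = 1 :=
    (measure_congr (Filter.eventuallyEq_univ.2 hdone)).trans measure_univ
  rw [hone] at hlim
  refine tendsto_of_tendsto_of_tendsto_of_le_of_le hlim tendsto_const_nhds (fun n => ?_)
    fun n => stoppedProb_le_one _ _ _ _ _
  have h := Strategy.law_done_le_stoppedLaw (delayStrategy_runs (A := A) D hD w D base) D n
    (root A w) fun _ _ => rfl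
  refine le_trans (le_of_eq ?_) h
  exact σ.pathMeasure_eval_apply w n (Node.conf ⁻¹' doneOutside A D)

/-- One stopped run bounds from below the probabilities in all ensembles that look like it: `w'` is
what the parties appear to have, `v` what they have, and `w` may differ from `w'` on the delayed
parties. -/
theorem stoppedProb_le_pathMeasure (C : Finset (Party t)) (hC : C.card ≤ t)
    {w w' v : Party t → V} (hw : ∀ i, i ∉ D → w i = w' i) (hv : ∀ i, i ∉ C → v i = w' i)
    {B : Set (Config A)} (hB : HistoryMono B) (n : ℕ) :
    stoppedProb A w (delaySched D base) D n B ≤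
      (delayStrategy A C hC w' D base).pathMeasure v {ω | (ω n).conf ∈ B} := by
  have h := Strategy.stoppedLaw_le_law (delayStrategy_runs (A := A) C hC w' D base) D hB n
    (root A v) hv
  refine (stoppedProb_congr (delays_delaySched D base) hw n hB v).symm.le.trans (h.trans ?_)
  exact ((delayStrategy A C hC w' D base).pathMeasure_eval_apply v n (Node.conf ⁻¹' B)).ge

/-- That the delay ends almost surely is inherited from the stopped run, hence from the ensemble in
which `D` is corrupted. Only now are honest delayed parties legitimate. -/
theorem delayStrategy_ae_fair (hAdv : CanRunAlgorithm Adv)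
    (hterm : ProbTermination Adv A) (hbase : Function.Surjective base) (hD : D.card ≤ t)
    (C : Finset (Party t)) (hC : C.card ≤ t) {w v : Party t → V} (hv : ∀ i, i ∉ C → v i = w i) :
    ∀ᵐ ω ∂((delayStrategy A C hC w D base).pathMeasure v),
      (delayStrategy A C hC w D base).Fair ω := by
  let σ := delayStrategy A C hC w D base
  have hlim := σ.tendsto_pathMeasure v (historyMono_doneOutside (A := A) D)
  have hge : 1 ≤ σ.pathMeasure v {ω | ∃ n, (ω n).conf ∈ doneOutside A D} :=
    le_of_tendsto_of_tendsto' (tendsto_stoppedProb_doneOutside hAdv hterm hbase hD w) hlim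
      fun n => stoppedProb_le_pathMeasure C hC (fun _ _ => rfl) hv (historyMono_doneOutside D) n
  have hmeas : MeasurableSet {ω : ℕ → Node A | ∃ n, (ω n).conf ∈ doneOutside A D} := by
    have : {ω : ℕ → Node A | ∃ n, (ω n).conf ∈ doneOutside A D} =
        ⋃ n, {ω | ω n ∈ Node.conf ⁻¹' doneOutside A D} := by
      ext ω; simp
    rw [this]
    exact .iUnion fun n => measurableSet_eval n _
  have hae : ∀ᵐ ω ∂(σ.pathMeasure v), ∃ n, (ω n).conf ∈ doneOutside A D :=
    (mem_ae_iff_prob_eq_one hmeas).2 (le_antisymm prob_le_one hge)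
  filter_upwards [hae, σ.ae_isPath v] with ω h hω
  exact delayStrategy_fair hbase hω (.inr h)

/-- The configurations in which all parties outside `D` have decided on `a`. -/
def allDecided (A : Algorithm.{u, w} t V) (D : Finset (Party t)) (a : V) : Set (Config A) :=
  {c | ∀ i, i ∉ D → (c.loc i).Decided a}

theorem historyMono_allDecided (D : Finset (Party t)) (a : V) :
    HistoryMono (allDecided A D a) :=
  fun _ _ h hc i hi => (h i).subset (hc i hi)

theorem exists_notMem_of_card_le {C D : Finset (Party t)} (hC : C.card ≤ t) (hD : D.card ≤ t) :
    ∃ i, i ∉ C ∧ i ∉ D := by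
  by_contra! h
  have : (Finset.univ : Finset (Party t)) ⊆ C ∪ D := fun i _ => by
    by_cases hi : i ∈ C
    · exact Finset.mem_union_left _ hi
    · exact Finset.mem_union_right _ (h i hi)
  have h1 := (Finset.card_le_card this).trans (Finset.card_union_le _ _)
  rw [Finset.card_univ, Fintype.card_fin] at h1
  omega

/-- If `a` is not an input, then the honest parties decide on an input at most with the
probability that the stopped run does not end with decisions on `a`. -/
theorem stoppedProb_allDecided_le (hAdv : CanRunAlgorithm Adv) (hagr : Agreement Adv A)
    (hD : D.card ≤ t) {w w' : Party t → V} (hw : ∀ i, i ∉ D → w i = w' i)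
    (C : Finset (Party t)) (hC : C.card ≤ t) (E : Ensemble A)
    (hE : E.strategy = delayStrategy A C hC w' D base)
    (hv : ∀ i, i ∉ C → E.inputs i = w' i) (a : V) (ha : a ∉ E.inputMultiset) (n : ℕ) :
    stoppedProb A w (delaySched D base) D n (allDecided A D a) ≤
      ENNReal.ofReal (1 - E.probDecidesInput) := by
  have hmem : E.strategy ∈ Adv A := hE ▸ delayStrategy_mem hAdv C hC w' D base
  have hhon : ∀ i, i ∉ C → E.Honest i := fun i hi => by
    rw [Ensemble.Honest, hE]; exact hi
  obtain ⟨i, hiC, hiD⟩ := exists_notMem_of_card_le hC hD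
  refine (stoppedProb_le_pathMeasure C hC hw hv (historyMono_allDecided D a) n).trans ?_
  rw [← hE]
  -- The honest undelayed party `i` has decided the non-input `a`; by Agreement with itself it
  -- cannot also decide an input.
  have hle : E.prob {ω | (ω n).conf ∈ allDecided A D a} ≤
      E.prob {ω | ∀ i, E.Honest i → ∃ x ∈ E.inputMultiset, Ensemble.Decides ω i x}ᶜ := by
    refine measure_mono_ae ?_
    filter_upwards [E.ae_isPath] with ω hω h h'
    obtain ⟨x, hx, hdec⟩ := h' i (hhon i hiC)
    have := hagr E hmem ω hω i i (hhon i hiC) (hhon i hiC) x a hdec ⟨n, h i hiD⟩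
    exact ha (this ▸ hx)
  refine hle.trans (le_of_eq ?_)
  rw [prob_compl_eq_one_sub E.measurableSet_decidesInput, Ensemble.probDecidesInput,
    ENNReal.ofReal_sub _ measureReal_nonneg, ENNReal.ofReal_one, ofReal_measureReal]

/-- If the parties outside `D` have all decided, then on a common value among the inputs, almost
surely. -/
theorem stoppedProb_doneOutside_le_sum [DecidableEq V] (hAdv : CanRunAlgorithm Adv)
    (hagr : Agreement Adv A) (hterm : ProbTermination Adv A) (hval : QualitativeValidity Adv A)
    (hbase : Function.Surjective base) (hD : D.card ≤ t) (w : Party t → V) (n : ℕ) :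
    stoppedProb A w (delaySched D base) D n (doneOutside A D) ≤
      ∑ a ∈ Finset.univ.image w, stoppedProb A w (delaySched D base) D n (allDecided A D a) := by
  have h0 : (∅ : Finset (Party t)).card ≤ t := by simp
  let E : Ensemble A := ⟨w, delayStrategy A ∅ h0 w D base,
    delayStrategy_ae_fair hAdv hterm hbase hD ∅ h0 fun _ _ => rfl⟩
  have hmem : E.strategy ∈ Adv A := delayStrategy_mem hAdv ∅ h0 w D base
  have hhon (i : Party t) : E.Honest i := Finset.notMem_empty i
  -- Without corrupted parties the validity bound is `1`, so these disagreements and non-input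
  -- decisions form a null event.
  let bad : Set (Config A) := {c | ∃ i j x y, (c.loc i).Decided x ∧ (c.loc j).Decided y ∧
    (x ≠ y ∨ x ∉ E.inputMultiset)}
  have hbad : HistoryMono bad := by
    rintro c c' h ⟨i, j, x, y, hx, hy, hxy⟩
    exact ⟨i, j, x, y, (h i).subset hx, (h j).subset hy, hxy⟩
  have hin : ∀ᵐ ω ∂E.prob, ∀ i, E.Honest i → ∃ x ∈ E.inputMultiset, Ensemble.Decides ω i x := by
    have hle := E.le_probDecidesInput hterm hval hmem
    have hnum : E.numCorrupted = 0 := rfl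
    rw [hnum, Nat.cast_zero, zero_div, sub_zero] at hle
    refine (mem_ae_iff_prob_eq_one E.measurableSet_decidesInput).2 ?_
    have h1 := le_antisymm E.probDecidesInput_le_one hle
    rwa [Ensemble.probDecidesInput, measureReal_def, ENNReal.toReal_eq_one_iff] at h1
  have hzero : stoppedProb A w (delaySched D base) D n bad = 0 := by
    refine le_antisymm ((stoppedProb_le_pathMeasure ∅ h0 (fun _ _ => rfl)
      (fun _ _ => rfl) hbad n).trans (le_of_eq ?_)) zero_le
    change E.prob {ω | (ω n).conf ∈ bad} = 0
    refine measure_mono_null_ae ?_ measure_empty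
    filter_upwards [hin, E.ae_isPath] with ω hω hpath
    rintro ⟨i, j, x, y, hx, hy, hxy | hxM⟩
    · exact hxy (hagr E hmem ω hpath i j (hhon i) (hhon j) x y ⟨n, hx⟩ ⟨n, hy⟩)
    · obtain ⟨x', hx', hdec⟩ := hω i (hhon i)
      have := hagr E hmem ω hpath i i (hhon i) (hhon i) x x' ⟨n, hx⟩ hdec
      exact hxM (this ▸ hx')
  have hsub : doneOutside A D ⊆ bad ∪ ⋃ a ∈ Finset.univ.image w, allDecided A D a := by
    intro c hc
    by_cases hb : c ∈ bad
    · exact .inl hb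
    obtain ⟨i, hi, -⟩ := exists_notMem_of_card_le hD hD
    obtain ⟨x, hx⟩ := hc i hi
    have hxM : x ∈ E.inputMultiset := by
      by_contra h
      exact hb ⟨i, i, x, x, hx, hx, .inr h⟩
    obtain ⟨j, -, hj⟩ := Multiset.mem_map.1 hxM
    refine .inr (Set.mem_biUnion (Finset.mem_image.2 ⟨j, Finset.mem_univ j, hj⟩) fun k hk => ?_)
    obtain ⟨y, hy⟩ := hc k hk
    have hxy : x = y := by
      by_contra h
      exact hb ⟨i, k, x, y, hx, hy, .inl h⟩
    rwa [hxy]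
  calc stoppedProb A w (delaySched D base) D n (doneOutside A D)
      ≤ stoppedProb A w (delaySched D base) D n
          (bad ∪ ⋃ a ∈ Finset.univ.image w, allDecided A D a) := measure_mono hsub
    _ ≤ stoppedProb A w (delaySched D base) D n bad + stoppedProb A w (delaySched D base) D n
          (⋃ a ∈ Finset.univ.image w, allDecided A D a) := measure_union_le _ _
    _ ≤ _ := by
      rw [hzero, zero_add]
      exact measure_biUnion_finset_le _ _

end Delayed

/-! ### The counting inequality and the conclusion -/

open Classical in
/-- If the values of the parties outside `C ∪ D` are balanced, then in some ensemble with the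
corrupted parties `C` the bound of Qualitative Validity is not exceeded. -/
theorem exists_ensemble_probDecidesInput_le (hAdv : CanRunAlgorithm Adv) (hagr : Agreement Adv A)
    (hterm : ProbTermination Adv A) (hval : QualitativeValidity Adv A) {C D : Finset (Party t)}
    (hC : C.card ≤ t) (hD : D.card = t) (hCD : Disjoint C D) (v : Party t → V) (z : V)
    (hz : ∀ i, v i ≠ z)
    (hbal : ∀ a, (Finset.univ.filter fun i => i ∉ C ∧ i ∉ D ∧ v i = a).card ≤ t) :
    ∃ E : Ensemble A, E.strategy ∈ Adv A ∧ E.strategy.corrupted = C ∧ E.inputs = v ∧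
      E.probDecidesInput ≤ 1 - (C.card : ℝ) / ((3 * t + 1 : ℝ) - t) := by
  obtain ⟨len, base, hbase⟩ := exists_surjective_entry t
  -- `w` describes the common stopped run, `w'` what the parties seem to have in the ensemble `E`.
  -- They may differ on `D`, whose members keep their true inputs in `E`.
  let w : Party t → V := fun i => if i ∈ C ∨ i ∈ D then z else v i
  let w' : Party t → V := fun i => if i ∈ C then z else v i
  have hvw' : ∀ i, i ∉ C → v i = w' i := fun i hi => (if_neg hi).symm
  have hww' : ∀ i, i ∉ D → w i = w' i := fun i hi => by simp [w, w', hi]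
  let E : Ensemble A := ⟨v, delayStrategy A C hC w' D base,
    delayStrategy_ae_fair hAdv hterm hbase hD.le C hC hvw'⟩
  refine ⟨E, delayStrategy_mem hAdv _ _ _ _ _, rfl, rfl, ?_⟩
  have hwz : ∀ i, w i ≠ z ↔ i ∉ C ∧ i ∉ D := fun i => by
    by_cases h : i ∈ C ∨ i ∈ D
    · simp only [w, if_pos h]; tauto
    · have := hz i
      simp only [w, if_neg h]; tauto
  let K : V → Finset (Party t) := fun a => Finset.univ.filter fun i => w i = a
  have hden : (0 : ℝ) < (3 * t + 1 : ℝ) - t := by linarith [(Nat.cast_nonneg t : (0 : ℝ) ≤ t)]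
  have hzE : ∀ n, stoppedProb A w (delaySched D base) D n (allDecided A D z) ≤
      ENNReal.ofReal (1 - E.probDecidesInput) := by
    refine stoppedProb_allDecided_le hAdv hagr hD.le hww' C hC E rfl hvw' z fun h => ?_
    obtain ⟨i, -, hi⟩ := Multiset.mem_map.1 h
    exact hz i hi
  have hother : ∀ a, a ≠ z → ∀ n, stoppedProb A w (delaySched D base) D n (allDecided A D a) ≤
      ENNReal.ofReal (((K a).card : ℝ) / ((3 * t + 1 : ℝ) - t)) := by
    intro a ha n
    -- Balance enters here: the holders of `a` are few enough to be corrupted.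
    have hK : (K a).card ≤ t := by
      refine (Finset.card_le_card fun i hi => ?_).trans (hbal a)
      simp only [K, Finset.mem_filter, Finset.mem_univ, true_and] at hi ⊢
      have h := (hwz i).1 (hi ▸ ha)
      refine ⟨h.1, h.2, ?_⟩
      rwa [hww' i h.2, ← hvw' i h.1] at hi
    -- The true inputs when the holders of `a` merely pretend: with their inputs replaced by `z`,
    -- the value `a` disappears from the inputs.
    let u : Party t → V := fun i => if w i = a then z else w i
    have huw : ∀ i, i ∉ K a → u i = w i := fun i hi =>
      if_neg (by simpa only [K, Finset.mem_filter, Finset.mem_univ, true_and] using hi)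
    let F : Ensemble A := ⟨u, delayStrategy A (K a) hK w D base,
      delayStrategy_ae_fair hAdv hterm hbase hD.le (K a) hK huw⟩
    refine (stoppedProb_allDecided_le hAdv hagr hD.le (fun _ _ => rfl) (K a) hK F rfl huw a
      (fun h => ?_) n).trans (ENNReal.ofReal_le_ofReal ?_)
    · obtain ⟨i, -, hi⟩ := Multiset.mem_map.1 h
      change (if w i = a then z else w i) = a at hi
      split_ifs at hi with h'
      · exact ha hi.symm
      · exact h' hi
    · have := F.le_probDecidesInput hterm hval (delayStrategy_mem hAdv _ _ _ _ _)
      have hnum : F.numCorrupted = (K a).card := rfl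
      rw [hnum] at this
      linarith
  let S : Finset V := (Finset.univ.image w).erase z
  -- The holders of values other than `z` are exactly the parties outside `C ∪ D`, of which there
  -- are `3t + 1 - t - |C|`.
  have hsumK : ∑ a ∈ S, (K a).card = 2 * t + 1 - C.card := by
    have hmaps : ∀ i ∈ Finset.univ.filter fun i => w i ≠ z, w i ∈ S := fun i hi =>
      Finset.mem_erase.2 ⟨(Finset.mem_filter.1 hi).2, Finset.mem_image_of_mem w (Finset.mem_univ i)⟩
    have h1 := Finset.card_eq_sum_card_fiberwise hmaps
    have h2 : (Finset.univ.filter fun i => w i ≠ z) = (C ∪ D)ᶜ := by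
      ext i
      simp [hwz]
    rw [h2, Finset.card_compl, Fintype.card_fin, Finset.card_union_of_disjoint hCD, hD] at h1
    have h3 : ∑ a ∈ S, (K a).card = ∑ a ∈ S, (((C ∪ D)ᶜ).filter fun i => w i = a).card := by
      refine Finset.sum_congr rfl fun a ha => congrArg _ ?_
      ext i
      rw [← h2]
      simp only [K, Finset.mem_filter, Finset.mem_univ, true_and]
      exact ⟨fun h => ⟨h ▸ (Finset.mem_erase.1 ha).1, h⟩, fun h => h.2⟩
    rw [h3, ← h1]
    omega
  have hbound : ∀ n, stoppedProb A w (delaySched D base) D n (doneOutside A D) ≤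
      ENNReal.ofReal ((1 - E.probDecidesInput) +
        ∑ a ∈ S, ((K a).card : ℝ) / ((3 * t + 1 : ℝ) - t)) := by
    intro n
    refine (stoppedProb_doneOutside_le_sum hAdv hagr hterm hval hbase hD.le w n).trans ?_
    have hnn : ∀ a ∈ S, 0 ≤ ((K a).card : ℝ) / ((3 * t + 1 : ℝ) - t) :=
      fun a _ => div_nonneg (Nat.cast_nonneg _) hden.le
    rw [ENNReal.ofReal_add (sub_nonneg.2 E.probDecidesInput_le_one) (Finset.sum_nonneg hnn),
      ENNReal.ofReal_sum_of_nonneg hnn]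
    calc ∑ a ∈ Finset.univ.image w, stoppedProb A w (delaySched D base) D n (allDecided A D a)
        ≤ ∑ a ∈ insert z S, stoppedProb A w (delaySched D base) D n (allDecided A D a) :=
          Finset.sum_le_sum_of_subset (Finset.insert_erase_subset z _)
      _ = stoppedProb A w (delaySched D base) D n (allDecided A D z) +
          ∑ a ∈ S, stoppedProb A w (delaySched D base) D n (allDecided A D a) :=
          Finset.sum_insert (Finset.notMem_erase z _)
      _ ≤ _ := add_le_add (hzE n)
          (Finset.sum_le_sum fun a ha => hother a (Finset.mem_erase.1 ha).1 n)
  -- The bound is independent of `n`, while the left side tends to `1` since the run stops almost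
  -- surely.
  have hlim := le_of_tendsto' (tendsto_stoppedProb_doneOutside hAdv hterm hbase hD.le w) hbound
  rw [ENNReal.one_le_ofReal, ← Finset.sum_div, ← Nat.cast_sum, hsumK,
    Nat.cast_sub (by omega)] at hlim
  push_cast at hlim
  have hfrac : (2 * t + 1 - C.card : ℝ) / ((3 * t + 1 : ℝ) - t) =
      1 - (C.card : ℝ) / ((3 * t + 1 : ℝ) - t) := by
    rw [eq_sub_iff_add_eq, ← add_div, div_eq_one_iff_eq hden.ne']
    ring
  rw [hfrac] at hlim
  linarith

theorem not_strictSomewhere (hV : ((3 * t + 1 : ℕ) : ℕ∞) < ENat.card V)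
    (hAdv : CanRunAlgorithm Adv) (hagr : Agreement Adv A)
    (hterm : ProbTermination Adv A) (hval : QualitativeValidity Adv A) :
    ¬ StrictSomewhere Adv A := by
  classical
  rintro ⟨f, hft, M, hM, hmult, hstrict⟩
  -- For `f = 0` the bound is `1` and cannot be exceeded; it only has to be checked that some
  -- ensemble with these inputs exists.
  rcases Nat.eq_zero_or_pos f with rfl | hf
  · obtain ⟨v, hv⟩ := exists_map_univ_eq M hM
    obtain ⟨len, base, hbase⟩ := exists_surjective_entry t
    have h0 : (∅ : Finset (Party t)).card ≤ t := by simp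
    let E : Ensemble A := ⟨v, delayStrategy A ∅ h0 v ∅ base,
      delayStrategy_ae_fair hAdv hterm hbase h0 ∅ h0 fun _ _ => rfl⟩
    have h := hstrict E (delayStrategy_mem hAdv _ _ _ _ _) rfl hv
    rw [Nat.cast_zero, zero_div, sub_zero] at h
    exact absurd E.probDecidesInput_le_one (not_le.2 h)
  · obtain ⟨v, C, D, hv, hC, hD, hCD, hbal⟩ :=
      exists_balanced_arrangement f hf hft M hM (by omega)
    -- A value that no party holds exists because `V` has more than `3t + 1` elements.
    obtain ⟨z, hz⟩ : ∃ z, ∀ i, v i ≠ z := by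
      by_contra! h
      have hsurj : Function.Surjective v := h
      have : ENat.card V ≤ ENat.card (Party t) :=
        ENat.card_le_card_of_injective (Function.injective_surjInv hsurj)
      rw [ENat.card_eq_coe_fintype_card (α := Party t), Fintype.card_fin] at this
      exact absurd this (not_le.2 hV)
    obtain ⟨E, hE, hEC, hEv, hle⟩ := exists_ensemble_probDecidesInput_le (A := A) hAdv hagr hterm
      hval (hC.le.trans hft) hD hCD v z hz hbal
    have h := hstrict E hE (by rw [Ensemble.numCorrupted, hEC, hC])
      (by rw [Ensemble.inputMultiset, hEv, hv])
    rw [hC] at hle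
    exact absurd hle (not_le.2 h)

end ByzAgr

theorem mainTheorem1 (t : ℕ) (V : Type*)
    (hV : ((3 * t + 1 : ℕ) : ℕ∞) < ENat.card V)
    (Adv : ByzAgr.AdversaryClass t V) (hAdv : ByzAgr.CanRunAlgorithm Adv)
    (Φ : ByzAgr.Algorithm t V → Prop) (hΦ : ByzAgr.StrictlyStronger Adv Φ) :
    ¬ ∃ A : ByzAgr.Algorithm t V,
      ByzAgr.Agreement Adv A ∧ ByzAgr.ProbTermination Adv A ∧ Φ A := by
  rintro ⟨A, hagr, hterm, hA⟩
  obtain ⟨hval, hstrict⟩ := hΦ A hA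
  exact ByzAgr.not_strictSomewhere hV hAdv hagr hterm hval hstrict
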